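/- Let $N\ge 1$, $M\ge 2$, $V\ge 1$ be integers and $\rho,\gamma\in(0,1]$, and exclude the case $V=1$, $N\ge2$, $\rho=\gamma=1$ (in which every reservation collides). Consider the following symmetric $N$-user network (Frame Slotted ALOHA with Reservation and Data slots, FSA-RD). Time is divided into slots $t=0,1,2,\dots$, slot $t$ occupying $[t,t+1)$, and frame $k\ge 0$ consists of the $M$ slots $kM,\dots,kM+M-1$: the first is the reservation slot, made up of $V$ mini-slots, and the other $M-1$ are data slots. At the beginning of each slot each user generates a status update with probability $\rho$. User $n$ has an update to transmit in frame $k\ge1$ if it generated at least one in frame $k-1$, and then the update is the most recent one of frame $k-1$; in frame $0$ there is none. A user that has an update to transmit in a frame makes a reservation in that frame with probability $\gamma$, by choosing one of the $V$ mini-slots uniformly. All these random choices are independent, over users, slots and frames. A reservation succeeds if no other user chose the same mini-slot in that frame. The first $M-1$ users with successful reservations, in the order of their mini-slots, transmit their updates, one each, in the data slots $1,2,\dots$ of the frame; an update transmitted in slot $t$ is received by the access point at time $t+1$. Updates that are not received in this frame are discarded. The age of information (AoI) of user $n$ is $\delta_n(t)=t-u_n(t)$, where $u_n(t)$ is the generation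 time of the update of user $n$ most recently received until time $t$ (with an arbitrary initial value before the first reception). Put $p=1-(1-\rho)^M$, and, with $0^0=1$, $$\pi_{n_2,n_3}=\frac{(-1)^{n_3}V!\,(n_2+1)!}{V^{n_2+1}\,n_3!}\sum_{m=n_3}^{\min\{V,n_2+1\}}\frac{(-1)^m(V-m)^{n_2+1-m}}{(m-n_3)!\,(V-m)!\,(n_2+1-m)!},$$ $$p_s=\sum_{n_1=0}^{N-1}\sum_{n_2=0}^{n_1}\sum_{n_3=1}^{\min\{V,n_2+1\}}\binom{N-1}{n_1}(1-p)^{N-1-n_1}p^{n_1}\binom{n_1}{n_2}(1-\gamma)^{n_1-n_2}\gamma^{n_2}\,\frac{\min\{n_3,M-1\}}{n_2+1}\,\pi_{n_2,n_3},$$ $$\varphi_\alpha=\sum_{n_1=0}^{N-1}\sum_{n_2=0}^{n_1}\sum_{n_3=\alpha-1}^{\min\{V,n_2+1\}}\binom{N-1}{n_1}(1-p)^{N-1-n_1}p^{n_1}\binom{n_1}{n_2}(1-\gamma)^{n_1-n_2}\gamma^{n_2}\,\frac{1}{n_2+1}\,\pi_{n_2,n_3}\qquad(2\le\alpha\le M).$$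 Then, for every user $n$: $p_s>0$; for every frame $k\ge1$, conditionally on user $n$ having an update and making a reservation in frame $k$, the probability that an update of user $n$ is received within frame $k$ is $p_s$, and the probability that it is transmitted and received in the $\alpha$-th slot of the frame (the $(\alpha-1)$-th data slot) is $\varphi_\alpha$ for $2\le\alpha\le M$; and the average AoI $\bar\Delta=\lim_{T\to\infty}\frac1T\sum_{t=0}^{T-1}\delta_n(t)$ exists almost surely and equals $$\bar\Delta=\frac{M}{\gamma p_s\left(1-(1-\rho)^M\right)}-\frac{M(1-\rho)^M}{1-(1-\rho)^M}+\frac1\rho-\frac{M+1}{2}+\frac{\sum_{\alpha=2}^{M}\alpha\,\varphi_\alpha}{p_s}.$$ -/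

import Mathlib

namespace FSARD

/-! ### The protocol on a fixed sample path

Slots are numbered `0, 1, 2, …`; slot `t` begins at time `t` and ends at time `t + 1`. Slot `t` is
in frame `t / M`, so frame `k` consists of the slots `k * M, …, k * M + (M - 1)`. The first slot of
a frame is the reservation slot (with `V` mini-slots), the other `M - 1` slots are data slots. -/

/-- The basic random choices of all `N` users, for one outcome. -/
structure Path (N V : ℕ) where
  /-- whether user `n` generates a status update at the beginning of slot `t` -/
  arrival : Fin N → ℕ → Bool
  /-- whether user `n` makes a reservation in frame `k`, should it have an update to transmit -/
  coin : Fin N → ℕ → Bool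
  /-- the mini-slot in which user `n` sends its reservation packet in frame `k`, if it reserves -/
  mini : Fin N → ℕ → Fin V

variable {N V : ℕ}

/-- The slots of frame `k - 1` in which user `n` generates a status update
(none if `k = 0`: the buffers are empty at the start). -/
def freshArrivals (M : ℕ) (P : Path N V) (n : Fin N) (k : ℕ) : Finset ℕ :=
  (Finset.range (k * M)).filter (fun t => t / M + 1 = k ∧ P.arrival n t = true)

/-- `I_n(k) = 1`: user `n` has a status update to transmit in frame `k`. -/
def HasUpdate (M : ℕ) (P : Path N V) (n : Fin N) (k : ℕ) : Prop :=
  (freshArrivals M P n k).Nonempty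

/-- The generation time of the update that user `n` holds for frame `k`: only the most recent
update of frame `k - 1` is kept. (Only used when `HasUpdate M P n k`.) -/
def genTime (M : ℕ) (P : Path N V) (n : Fin N) (k : ℕ) : ℕ :=
  (freshArrivals M P n k).sup id

/-- `I_n(k) = 1` and `J_n(k) = 1`: user `n` has an update and makes a reservation in frame `k`. -/
def Reserves (M : ℕ) (P : Path N V) (n : Fin N) (k : ℕ) : Prop :=
  HasUpdate M P n k ∧ P.coin n k = true

/-- User `n` makes a reservation in frame `k` which does not collide. -/
def ReservationSucceeds (M : ℕ) (P : Path N V) (n : Fin N) (k : ℕ) : Prop :=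
  Reserves M P n k ∧ ∀ m : Fin N, m ≠ n → Reserves M P m k → P.mini m k ≠ P.mini n k

open Classical in
/-- The number of successful reservations of frame `k` in mini-slots before that of user `n`. -/
noncomputable def rank (M : ℕ) (P : Path N V) (n : Fin N) (k : ℕ) : ℕ :=
  (Finset.univ.filter
    (fun m : Fin N => ReservationSucceeds M P m k ∧ P.mini m k < P.mini n k)).card

/-- The access point receives a status update of user `n` in slot `t`. The successful users of a
frame use its data slots `1, …, M - 1` in the order of their reservations. Since `t % M < M`, only
the first `M - 1` of them are served. -/
def Received (M : ℕ) (P : Path N V) (n : Fin N) (t : ℕ) : Prop :=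
  ReservationSucceeds M P n (t / M) ∧ t % M = rank M P n (t / M) + 1

/-- `I_a^n(k) = 1`: the access point receives a status update of user `n` within frame `k`. -/
def ReceivedInFrame (M : ℕ) (P : Path N V) (n : Fin N) (k : ℕ) : Prop :=
  ∃ t : ℕ, t / M = k ∧ Received M P n t

open Classical in
/-- `u_n(t)`: the generation time of the status update of user `n` that was most recently received
until time `t` (a reception in slot `t` is complete at time `t + 1`);
`u₀` is the initial value, for the time before the first reception. -/
noncomputable def latestGen (M : ℕ) (P : Path N V) (n : Fin N) (u₀ : ℤ) : ℕ → ℤ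
  | 0 => u₀
  | t + 1 => if Received M P n t then (genTime M P n (t / M) : ℤ) else latestGen M P n u₀ t

/-- The age of information `δ_n(t) = t - u_n(t)`. -/
noncomputable def aoi (M : ℕ) (P : Path N V) (n : Fin N) (u₀ : ℤ) (t : ℕ) : ℤ :=
  (t : ℤ) - latestGen M P n u₀ t

/-! ### The probabilistic model -/

/-- Labels of the basic random variables. -/
inductive Source (N : ℕ) : Type
  | arrival (n : Fin N) (t : ℕ)
  | coin (n : Fin N) (k : ℕ)
  | mini (n : Fin N) (k : ℕ)

/-- The finite set in which a basic random variable takes its values. -/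
def Source.Value (V : ℕ) : Source N → Type
  | .arrival _ _ => Bool
  | .coin _ _ => Bool
  | .mini _ _ => Fin V

instance (s : Source N) : MeasurableSpace (s.Value V) := ⊤

/-- A random path, as one family of random variables. -/
def family {Ω : Type*} (P : Ω → Path N V) : (s : Source N) → Ω → s.Value V
  | .arrival n t => fun ω => (P ω).arrival n t
  | .coin n k => fun ω => (P ω).coin n k
  | .mini n k => fun ω => (P ω).mini n k

/-- The symmetric network: Bernoulli(`ρ`) arrivals in each slot, reservation probability `γ`,
uniform choice of the mini-slot, everything mutually independent. -/
structure IsNetwork {Ω : Type*} [MeasurableSpace Ω] (μ : MeasureTheory.Measure Ω)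
    (ρ γ : ℝ) (P : Ω → Path N V) : Prop where
  measurable : ∀ s : Source N, Measurable (family P s)
  indep : ProbabilityTheory.iIndepFun (family P) μ
  arrival_law : ∀ (n : Fin N) (t : ℕ), μ.real {ω | (P ω).arrival n t = true} = ρ
  coin_law : ∀ (n : Fin N) (k : ℕ), μ.real {ω | (P ω).coin n k = true} = γ
  mini_law : ∀ (n : Fin N) (k : ℕ) (v : Fin V), μ.real {ω | (P ω).mini n k = v} = 1 / (V : ℝ)

/-! ### The closed forms -/

/-- `p = 1 - (1 - ρ)^M`. -/
noncomputable def pUpdate (M : ℕ) (ρ : ℝ) : ℝ := 1 - (1 - ρ) ^ M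

/-- The closed form of `Pr(N_s = n₃ | N_r = r - 1)`. -/
noncomputable def singlePMF (V r n₃ : ℕ) : ℝ :=
  (-1) ^ n₃ * (V.factorial : ℝ) * (r.factorial : ℝ) / ((V : ℝ) ^ r * (n₃.factorial : ℝ)) *
    ∑ m ∈ Finset.Icc n₃ (min V r),
      (-1) ^ m * ((V - m : ℕ) : ℝ) ^ (r - m) /
        (((m - n₃).factorial : ℝ) * ((V - m).factorial : ℝ) * ((r - m).factorial : ℝ))

/-- The closed form of `Pr(N_g = n₁, N_r = n₂)`. -/
noncomputable def othersPMF (N M : ℕ) (ρ γ : ℝ) (n₁ n₂ : ℕ) : ℝ :=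
  ((N - 1).choose n₁ : ℝ) * (1 - pUpdate M ρ) ^ (N - 1 - n₁) * pUpdate M ρ ^ n₁ *
    ((n₁.choose n₂ : ℝ) * (1 - γ) ^ (n₁ - n₂) * γ ^ n₂)

/-- The closed form of `p_s`. -/
noncomputable def pS (N M V : ℕ) (ρ γ : ℝ) : ℝ :=
  ∑ n₁ ∈ Finset.Icc 0 (N - 1), ∑ n₂ ∈ Finset.Icc 0 n₁, ∑ n₃ ∈ Finset.Icc 1 (min V (n₂ + 1)),
    othersPMF N M ρ γ n₁ n₂ * ((min n₃ (M - 1) : ℕ) / ((n₂ : ℝ) + 1)) * singlePMF V (n₂ + 1) n₃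

/-- The closed form of `φ_α`, for `2 ≤ α ≤ M`. -/
noncomputable def phi (N M V : ℕ) (ρ γ : ℝ) (α : ℕ) : ℝ :=
  ∑ n₁ ∈ Finset.Icc 0 (N - 1), ∑ n₂ ∈ Finset.Icc 0 n₁,
    ∑ n₃ ∈ Finset.Icc (α - 1) (min V (n₂ + 1)),
      othersPMF N M ρ γ n₁ n₂ * (1 / ((n₂ : ℝ) + 1)) * singlePMF V (n₂ + 1) n₃

end FSARD

namespace FSARD

/-! What happens in a frame is a function of one finite vector: the users' arrivals in the preceding
frame, their coins and their mini-slots. These vectors are independent and identically distributed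
over the frames. So the theorem splits into a computation for one frame and a law of large numbers
over frames.

One frame. Given the set R of reserving users, the successful ones are the points of R at which a
uniformly random map to the mini-slots takes a value exactly once on R. Counting injections gives
the binomial moments of their number (`card_subset_singles`, `sum_choose_card_singles`), and
binomial inversion gives its law (`card_card_singles_eq`). A success of rank j exists exactly when
more than j users succeed, and by symmetry it is each member of R equally often; hence the factor
1/|R| in `card_singleRank_eq`. Averaging over R, where the number of other reserving users is
binomial with parameters N - 1 and pγ, yields φ (`sum_weight_served`). In that lemma a function of
the user's own arrivals factors out, so the serving slot and the age of the update decouple. Finally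
p_s is the sum of the φ_α (`pS_eq_sum_phi`).

Many frames. The age A_k of a user at the start of frame k + 1 grows by M, or is reset to W = 2M - L
when the user is served, L being the position of its last arrival. Its second moments are bounded
(`exists_integral_resetAge_sq_le`). As A_k depends on the past only, the terms A_k (ξ(X_k) - Eξ) are
orthogonal, and their averages along the squares tend to 0 almost surely (`ae_tendsto_sum_sq`). With
ξ the reset indicator, of mean q, the telescoped recursion gives q · mean(A) = M + E[reset · (W -
M)], with no appeal to stationarity. With ξ the time left in the frame after reception, the same law
handles the ages inside a frame (`sum_aoi_frame`). Ages are nonnegative when the initial value is 0,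
so their partial sums are monotone and the limit along squares is the full limit; one reception
removes the influence of the initial value. -/

open Finset MeasureTheory ProbabilityTheory Filter Topology

/-! ### Counting the isolated points of a map -/

section Counting

variable {ι : Type*} [Fintype ι] [DecidableEq ι] {V : ℕ}

/-- The elements of `R` whose value under `f` is taken only once on `R`. -/
def singles (R : Finset ι) (f : ι → Fin V) : Finset ι :=
  R.filter fun i => ∀ j ∈ R, j ≠ i → f j ≠ f i

/-- The number of singles of `R` with a value smaller than that of `i`. -/
def singleRank (R : Finset ι) (f : ι → Fin V) (i : ι) : ℕ :=
  ((singles R f).filter fun j => f j < f i).card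

lemma mem_singles {R : Finset ι} {f : ι → Fin V} {i : ι} :
    i ∈ singles R f ↔ i ∈ R ∧ ∀ j ∈ R, j ≠ i → f j ≠ f i := by
  simp [singles]

lemma singles_subset (R : Finset ι) (f : ι → Fin V) : singles R f ⊆ R :=
  Finset.filter_subset _ _

lemma injOn_singles (R : Finset ι) (f : ι → Fin V) : Set.InjOn f (singles R f) := by
  intro i hi j hj hij
  by_contra hne
  exact (mem_singles.1 hj).2 i (mem_singles.1 hi).1 hne hij

lemma card_singles_le (R : Finset ι) (f : ι → Fin V) : (singles R f).card ≤ min V R.card := by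
  refine le_min ?_ (card_le_card (singles_subset R f))
  rw [← card_image_of_injOn (injOn_singles R f)]
  exact (card_le_univ _).trans_eq (Fintype.card_fin V)

/-- Among the singles every rank below their number is attained exactly once. -/
lemma card_filter_singleRank_eq (R : Finset ι) (f : ι → Fin V) (j : ℕ) :
    ((singles R f).filter fun i => singleRank R f i = j).card =
      if j < (singles R f).card then 1 else 0 := by
  set T := singles R f with hT
  have hlt : ∀ i ∈ T, singleRank R f i < T.card := fun i hi =>
    card_lt_card (filter_ssubset.2 ⟨i, hi, lt_irrefl _⟩)
  -- Strict, because `i` itself is counted in the rank of `i'` but not in its own.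
  have hmono : ∀ i ∈ T, ∀ i' ∈ T, f i < f i' → singleRank R f i < singleRank R f i' := by
    intro i hi i' hi' h
    refine card_lt_card ⟨fun x hx => ?_, fun hsub => ?_⟩
    · simp only [mem_filter] at hx ⊢
      exact ⟨hx.1, hx.2.trans h⟩
    · have := hsub (mem_filter.2 ⟨hi, h⟩)
      exact lt_irrefl _ (mem_filter.1 this).2
  have hinj : Set.InjOn (singleRank R f) T := by
    intro i hi i' hi' h
    rcases lt_trichotomy (f i) (f i') with h1 | h1 | h1
    · exact absurd h (hmono i hi i' hi' h1).ne
    · exact injOn_singles R f hi hi' h1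
    · exact absurd h (hmono i' hi' i hi h1).ne'
  have himg : T.image (singleRank R f) = range T.card := by
    refine eq_of_subset_of_card_le (fun x hx => ?_) ?_
    · obtain ⟨i, hi, rfl⟩ := mem_image.1 hx
      exact mem_range.2 (hlt i hi)
    · rw [card_image_of_injOn hinj, card_range]
  split_ifs with h
  · obtain ⟨i, hi, hij⟩ := mem_image.1 (himg ▸ mem_range.2 h)
    rw [card_eq_one]
    refine ⟨i, ?_⟩
    ext x
    simp only [mem_filter, mem_singleton]
    constructor
    · rintro ⟨hx, hxj⟩
      exact hinj hx hi (hxj.trans hij.symm)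
    · rintro rfl
      exact ⟨hi, hij⟩
  · rw [card_eq_zero, filter_eq_empty_iff]
    intro i hi hij
    exact h (hij ▸ hlt i hi)

/-- Relabelling by a permutation that preserves `R` carries singles to singles; with the matching
statement for ranks this is the symmetry between users. -/
lemma mem_singles_comp_perm {R : Finset ι} {f : ι → Fin V} {e : Equiv.Perm ι}
    (he : ∀ i, e i ∈ R ↔ i ∈ R) (i : ι) : i ∈ singles R (f ∘ e) ↔ e i ∈ singles R f := by
  simp only [mem_singles, he, Function.comp]
  refine and_congr_right fun _ => ⟨fun h j hj hne => ?_, fun h j hj hne => ?_⟩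
  · have := h (e.symm j) (by rw [← he]; simpa using hj)
      (fun h' => hne (by rw [← h', Equiv.apply_symm_apply]))
    simpa using this
  · exact h (e j) ((he j).2 hj) (fun h' => hne (e.injective h'))

lemma singleRank_comp_perm {R : Finset ι} {f : ι → Fin V} {e : Equiv.Perm ι}
    (he : ∀ i, e i ∈ R ↔ i ∈ R) (i : ι) : singleRank R (f ∘ e) i = singleRank R f (e i) := by
  refine card_bij (fun j _ => e j) (fun j hj => ?_) (fun _ _ _ _ h => e.injective h)
    (fun j hj => ⟨e.symm j, ?_, by simp⟩)
  · simp only [mem_filter, mem_singles_comp_perm he] at hj ⊢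
    exact hj
  · simp only [mem_filter, mem_singles_comp_perm he] at hj ⊢
    simpa using hj

/-- By symmetry, every element of `R` is equally often the single of rank `j`. -/
lemma card_mul_card_singleRank_eq (R : Finset ι) {i : ι} (hi : i ∈ R) (j : ℕ) :
    R.card * (univ.filter fun f : ι → Fin V => i ∈ singles R f ∧ singleRank R f i = j).card =
      (univ.filter fun f : ι → Fin V => j < (singles R f).card).card := by
  have hsymm : ∀ k ∈ R,
      (univ.filter fun f : ι → Fin V => k ∈ singles R f ∧ singleRank R f k = j).card =
      (univ.filter fun f : ι → Fin V => i ∈ singles R f ∧ singleRank R f i = j).card := by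
    intro k hk
    -- The swap preserves `R` since both `i` and `k` lie in it, so precomposing with it exchanges
    -- their roles.
    have he : ∀ x, Equiv.swap i k x ∈ R ↔ x ∈ R := by
      intro x
      rcases eq_or_ne x i with rfl | hxi
      · simp [hk, hi]
      rcases eq_or_ne x k with rfl | hxk
      · simp [hk, hi]
      rw [Equiv.swap_apply_of_ne_of_ne hxi hxk]
    refine card_bij (fun f _ => f ∘ Equiv.swap i k) (fun f hf => ?_) (fun f _ g _ h => ?_)
      (fun f hf => ⟨f ∘ Equiv.swap i k, ?_, ?_⟩)
    · simpa [mem_singles_comp_perm he, singleRank_comp_perm he] using hf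
    · funext x
      have := congrFun h (Equiv.swap i k x)
      simpa using this
    · simpa [mem_singles_comp_perm he, singleRank_comp_perm he] using hf
    · funext x
      simp
  calc _ = ∑ k ∈ R,
        (univ.filter fun f : ι → Fin V => k ∈ singles R f ∧ singleRank R f k = j).card := by
        rw [sum_congr rfl hsymm, sum_const, smul_eq_mul]
    _ = ∑ f : ι → Fin V, ((singles R f).filter fun k => singleRank R f k = j).card := by
        simp only [card_filter]
        rw [sum_comm]
        refine sum_congr rfl fun f _ => ?_
        rw [← sum_filter, ← sum_filter]
        refine sum_congr ?_ fun _ _ => rfl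
        ext k
        simp only [mem_filter]
        exact ⟨fun h => h.2, fun h => ⟨singles_subset R f h.1, h⟩⟩
    _ = _ := by
        rw [card_filter]
        exact sum_congr rfl fun f _ => card_filter_singleRank_eq R f j

/-- The number of maps for which all elements of `U ⊆ R` are singles of `R`. -/
lemma card_subset_singles {R U : Finset ι} (hU : U ⊆ R) :
    (univ.filter fun f : ι → Fin V => U ⊆ singles R f).card =
      V.descFactorial U.card * (V - U.card) ^ (R.card - U.card) *
        V ^ (Fintype.card ι - R.card) := by
  -- The restriction of `f` to `U` must be an embedding `g`. For fixed `g` the admissible maps form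
  -- a box: values on `U` are forced, the rest of `R` avoids the image of `g`, and points outside
  -- `R` are free.
  let t : (U ↪ Fin V) → ι → Finset (Fin V) := fun g i =>
    if h : i ∈ U then {g ⟨i, h⟩} else if i ∈ R then (univ.map g)ᶜ else univ
  have ht : ∀ g f, f ∈ Fintype.piFinset (t g) ↔
      (∀ i : U, f i = g i) ∧ ∀ i ∈ R, i ∉ U → ∀ j : U, g j ≠ f i := by
    intro g f
    simp only [Fintype.mem_piFinset, t]
    constructor
    · intro h
      refine ⟨fun i => ?_, fun i hi hiU j hj => ?_⟩
      · simpa using h i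
      · have := h i
        simp only [hiU, hi, dif_neg, not_false_iff, if_true, mem_compl, Finset.mem_map, mem_univ,
          true_and, not_exists] at this
        exact this j hj
    · rintro ⟨h1, h2⟩ i
      split_ifs with hU' hR
      · simpa using h1 ⟨i, hU'⟩
      · simpa using fun j hj => h2 i hR hU' ⟨j, hj⟩
      · exact mem_univ _
  have heq : (univ.filter fun f : ι → Fin V => U ⊆ singles R f) =
      (univ : Finset (U ↪ Fin V)).biUnion fun g => Fintype.piFinset (t g) := by
    ext f
    simp only [mem_filter, mem_univ, true_and, mem_biUnion, ht]
    constructor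
    · intro h
      refine ⟨⟨fun i => f i, fun i j hij => ?_⟩, fun _ => rfl, fun i hi hiU j hj => ?_⟩
      · by_contra hne
        exact (mem_singles.1 (h j.2)).2 i (hU i.2) (fun h' => hne (Subtype.ext h')) hij
      · exact (mem_singles.1 (h j.2)).2 i hi (fun h' => hiU (h' ▸ j.2)) hj.symm
    · rintro ⟨g, h1, h2⟩ i hi
      refine mem_singles.2 ⟨hU hi, fun j hj hji hf => ?_⟩
      by_cases hjU : j ∈ U
      · rw [h1 ⟨j, hjU⟩, h1 ⟨i, hi⟩] at hf
        exact hji (congrArg Subtype.val (g.injective hf))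
      · exact h2 j hj hjU ⟨i, hi⟩ (by rw [← h1 ⟨i, hi⟩, hf])
  have hcard : ∀ g : U ↪ Fin V, (Fintype.piFinset (t g)).card =
      (V - U.card) ^ (R.card - U.card) * V ^ (Fintype.card ι - R.card) := by
    intro g
    rw [Fintype.card_piFinset]
    have hsplit : ∀ i, (t g i).card = (if i ∈ R \ U then V - U.card else 1) *
        (if i ∈ Rᶜ then V else 1) := by
      intro i
      by_cases hiU : i ∈ U
      · simp [t, hiU, hU hiU]
      · by_cases hiR : i ∈ R
        · simp [t, hiU, hiR, card_compl]
        · simp [t, hiU, hiR]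
    rw [prod_congr rfl fun i _ => hsplit i, prod_mul_distrib, prod_ite_mem, prod_ite_mem]
    simp [card_sdiff_of_subset hU, card_compl]
  rw [heq, card_biUnion, sum_congr rfl fun g _ => hcard g]
  · simp [Fintype.card_embedding_eq, mul_assoc]
  · intro g _ g' _ hne
    rw [Function.onFun, Finset.disjoint_left]
    intro f hf hf'
    refine hne (DFunLike.ext _ _ fun i => ?_)
    rw [← ((ht g f).1 hf).1 i, ← ((ht g' f).1 hf').1 i]

/-- Binomial inversion at a point. -/
lemma sum_neg_one_pow_mul_choose_mul_choose (s X b : ℕ) (hX : X ≤ b) :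
    ∑ m ∈ Icc s b, (-1 : ℝ) ^ m * (m.choose s : ℝ) * (X.choose m : ℝ) =
      if X = s then (-1) ^ s else 0 := by
  rcases lt_or_ge X s with h | h
  · rw [if_neg h.ne]
    refine sum_eq_zero fun m hm => ?_
    rw [Nat.choose_eq_zero_of_lt (h.trans_le (mem_Icc.1 hm).1)]
    simp
  obtain ⟨d, rfl⟩ := Nat.exists_eq_add_of_le h
  have hsub : Icc s (s + d) ⊆ Icc s b := Icc_subset_Icc_right hX
  -- Terms beyond `X` vanish, so the upper limit `b` matters only through `X ≤ b`.
  rw [← sum_subset hsub]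
  · have : Icc s (s + d) = (range (d + 1)).map (addLeftEmbedding s) := by
      rw [range_eq_Ico, map_add_left_Ico]
      ext x; simp; omega
    rw [this, sum_map]
    -- Trinomial revision pulls out the constant binomial coefficient and leaves the alternating sum
    -- of row `d`, which vanishes unless `d = 0`.
    have h2 : ∀ i ∈ range (d + 1), (-1 : ℝ) ^ (addLeftEmbedding s i) *
        ((addLeftEmbedding s i).choose s : ℝ) * ((s + d).choose (addLeftEmbedding s i) : ℝ) =
        (-1) ^ s * ((s + d).choose s) * ((-1) ^ i * (d.choose i : ℝ)) := by
      intro i hi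
      have hi' : i ≤ d := Nat.lt_succ_iff.1 (mem_range.1 hi)
      have := Nat.choose_mul (n := s + d) (k := s + i) (s := s) (by omega)
      simp only [Nat.add_sub_cancel_left] at this
      have h3 : ((s + d).choose (s + i) : ℝ) * ((s + i).choose s : ℝ) =
        ((s + d).choose s : ℝ) * (d.choose i : ℝ) := by exact_mod_cast this
      simp only [addLeftEmbedding_apply, pow_add]
      linear_combination (-1) ^ s * (-1) ^ i * h3
    rw [sum_congr rfl h2, ← mul_sum]
    have h4 := Int.alternating_sum_range_choose (n := d)
    have h5 : ∑ i ∈ range (d + 1), (-1 : ℝ) ^ i * (d.choose i : ℝ) = if d = 0 then 1 else 0 := by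
      exact_mod_cast h4
    rw [h5]
    by_cases hd : d = 0
    · simp [hd]
    · simp [hd]
  · intro m hm hm'
    rw [Nat.choose_eq_zero_of_lt (n := s + d)]
    · simp
    · simp only [mem_Icc] at hm hm'; omega

/-- Double counting of pairs of a map and an `m`-subset of its singles: every `m`-subset `U` of `R`
contributes the number found in `card_subset_singles`. -/
lemma sum_choose_card_singles (R : Finset ι) (m : ℕ) :
    ∑ f : ι → Fin V, ((singles R f).card.choose m) =
      R.card.choose m * (V.descFactorial m * (V - m) ^ (R.card - m) *
        V ^ (Fintype.card ι - R.card)) := by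
  have h1 : ∀ f : ι → Fin V, (singles R f).card.choose m =
      ∑ U ∈ powersetCard m R, if U ⊆ singles R f then 1 else 0 := by
    intro f
    rw [← card_powersetCard, ← card_filter]
    congr 1
    ext U
    simp only [mem_powersetCard, mem_filter]
    exact ⟨fun h => ⟨⟨h.1.trans (singles_subset R f), h.2⟩, h.1⟩, fun h => ⟨h.2, h.1.2⟩⟩
  rw [sum_congr rfl fun f _ => h1 f, sum_comm, ← card_powersetCard m R, ← smul_eq_mul,
    ← sum_const]
  refine sum_congr rfl fun U hU => ?_
  obtain ⟨hUR, rfl⟩ := mem_powersetCard.1 hU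
  rw [← card_filter, card_subset_singles hUR]

/-- The law of the number of singles of a uniformly random map. -/
lemma card_card_singles_eq (hV : 1 ≤ V) (R : Finset ι) (s : ℕ) :
    ((univ.filter fun f : ι → Fin V => (singles R f).card = s).card : ℝ) =
      (V : ℝ) ^ Fintype.card ι * singlePMF V R.card s := by
  have hV0 : (V : ℝ) ≠ 0 := by positivity
  -- Binomial inversion writes the indicator of having `s` singles through binomial coefficients of
  -- their number, whose sums over all maps are known.
  have h1 : ((univ.filter fun f : ι → Fin V => (singles R f).card = s).card : ℝ) =
      ∑ f : ι → Fin V, (-1) ^ s * ∑ m ∈ Icc s (min V R.card),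
        (-1 : ℝ) ^ m * (m.choose s : ℝ) * ((singles R f).card.choose m : ℝ) := by
    rw [card_filter]
    push_cast
    refine sum_congr rfl fun f _ => ?_
    rw [sum_neg_one_pow_mul_choose_mul_choose _ _ _ (card_singles_le R f)]
    split_ifs
    · rw [← mul_pow]; simp
    · simp
  rw [h1, ← mul_sum, sum_comm, singlePMF, mul_sum, mul_sum, mul_sum]
  refine sum_congr rfl fun m hm => ?_
  have hm1 : s ≤ m := (mem_Icc.1 hm).1
  have hmV : m ≤ V := (mem_Icc.1 hm).2.trans (min_le_left _ _)
  have hmR : m ≤ R.card := (mem_Icc.1 hm).2.trans (min_le_right _ _)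
  have h2 : (∑ f : ι → Fin V, ((singles R f).card.choose m : ℝ)) =
      (R.card.choose m : ℝ) * ((V.descFactorial m : ℝ) * ((V - m : ℕ) : ℝ) ^ (R.card - m) *
        (V : ℝ) ^ (Fintype.card ι - R.card)) := by
    exact_mod_cast sum_choose_card_singles (V := V) R m
  have h3 : (V.descFactorial m : ℝ) = V.factorial / (V - m).factorial := by
    rw [eq_div_iff (by positivity)]
    exact_mod_cast (mul_comm _ _).trans (Nat.factorial_mul_descFactorial hmV)
  have h4 : (V : ℝ) ^ Fintype.card ι = V ^ R.card * V ^ (Fintype.card ι - R.card) := by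
    rw [← pow_add, Nat.add_sub_cancel' (card_le_univ R)]
  rw [← mul_sum, h2, h3, h4, Nat.cast_choose ℝ hm1, Nat.cast_choose ℝ hmR]
  field_simp

/-- The law of the rank of a given user among the successful ones. -/
lemma card_singleRank_eq (hV : 1 ≤ V) (R : Finset ι) {i : ι} (hi : i ∈ R) (j : ℕ) :
    ((univ.filter fun f : ι → Fin V => i ∈ singles R f ∧ singleRank R f i = j).card : ℝ) =
      (V : ℝ) ^ Fintype.card ι *
        ((1 / (R.card : ℝ)) * ∑ s ∈ Icc (j + 1) (min V R.card), singlePMF V R.card s) := by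
  have hR : (R.card : ℝ) ≠ 0 := by
    exact_mod_cast (card_pos.2 ⟨i, hi⟩).ne'
  have h1 : ((univ.filter fun f : ι → Fin V => j < (singles R f).card).card : ℝ) =
      ∑ s ∈ Icc (j + 1) (min V R.card), (V : ℝ) ^ Fintype.card ι * singlePMF V R.card s := by
    simp_rw [← card_card_singles_eq hV]
    rw [← Nat.cast_sum, Nat.cast_inj,
      card_eq_sum_card_fiberwise (f := fun f => (singles R f).card)
        (t := Icc (j + 1) (min V R.card))]
    · refine sum_congr rfl fun s hs => ?_
      congr 1
      ext f
      have := (mem_Icc.1 hs).1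
      simp only [mem_filter, mem_univ, true_and]
      omega
    · intro f hf
      simp only [coe_filter, mem_univ, true_and, Set.mem_ofPred_eq] at hf
      simpa using ⟨hf, by simpa using card_singles_le R f⟩
  have h2 := card_mul_card_singleRank_eq (V := V) R hi j
  have h3 : (R.card : ℝ) *
      ((univ.filter fun f : ι → Fin V => i ∈ singles R f ∧ singleRank R f i = j).card : ℝ) =
      ((univ.filter fun f : ι → Fin V => j < (singles R f).card).card : ℝ) := by
    exact_mod_cast h2
  rw [h1, ← mul_sum] at h3
  field_simp
  linear_combination h3

end Counting

/-! ### Closed forms -/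

/-- Thinning a binomial law. -/
lemma sum_binomial_thinning (L : ℕ) (p γ : ℝ) (F : ℕ → ℝ) :
    ∑ n₁ ∈ Icc 0 L, ∑ n₂ ∈ Icc 0 n₁, (L.choose n₁ : ℝ) * (1 - p) ^ (L - n₁) * p ^ n₁ *
        ((n₁.choose n₂ : ℝ) * (1 - γ) ^ (n₁ - n₂) * γ ^ n₂) * F n₂ =
      ∑ n₂ ∈ range (L + 1), (L.choose n₂ : ℝ) * ((p * γ) ^ n₂ * (1 - p * γ) ^ (L - n₂)) * F n₂ := by
  rw [sum_comm' (t' := range (L + 1)) (s' := fun n₂ => Icc n₂ L)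
    (by intro x y; simp only [mem_Icc, mem_range]; omega)]
  refine sum_congr rfl fun n₂ hn₂ => ?_
  obtain ⟨d, rfl⟩ := Nat.exists_eq_add_of_le (Nat.lt_succ_iff.1 (mem_range.1 hn₂))
  have : Icc n₂ (n₂ + d) = (range (d + 1)).map (addLeftEmbedding n₂) := by
    rw [range_eq_Ico, map_add_left_Ico]
    ext x; simp; omega
  -- A user that does not reserve either has an update and declines, or has none; expanding the
  -- power of p(1 - γ) + (1 - p) recovers the sum over `n₁`.
  rw [this, sum_map, Nat.add_sub_cancel_left,
    show 1 - p * γ = p * (1 - γ) + (1 - p) by ring, add_pow, mul_sum, mul_sum, sum_mul]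
  refine sum_congr rfl fun i hi => ?_
  have hi' : i ≤ d := Nat.lt_succ_iff.1 (mem_range.1 hi)
  have h := Nat.choose_mul (n := n₂ + d) (k := n₂ + i) (s := n₂) (by omega)
  simp only [Nat.add_sub_cancel_left] at h
  have h3 : ((n₂ + d).choose (n₂ + i) : ℝ) * ((n₂ + i).choose n₂ : ℝ) =
    ((n₂ + d).choose n₂ : ℝ) * (d.choose i : ℝ) := by exact_mod_cast h
  simp only [addLeftEmbedding_apply, Nat.add_sub_cancel_left, Nat.add_sub_add_left, pow_add,
    mul_pow]
  linear_combination ((1 - p) ^ (d - i) * p ^ n₂ * p ^ i * (1 - γ) ^ i * γ ^ n₂ * F n₂) * h3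

/-- The last factor does not involve `n₁`, so thinning collapses the two binomial laws to one with
success probability pγ. -/
lemma phi_eq_sum_binomial (N M V : ℕ) (ρ γ : ℝ) (α : ℕ) :
    phi N M V ρ γ α = ∑ r ∈ range (N - 1 + 1), ((N - 1).choose r : ℝ) *
      ((pUpdate M ρ * γ) ^ r * (1 - pUpdate M ρ * γ) ^ (N - 1 - r)) *
      ((1 / ((r : ℝ) + 1)) * ∑ s ∈ Icc (α - 1) (min V (r + 1)), singlePMF V (r + 1) s) := by
  rw [← sum_binomial_thinning, phi]
  refine sum_congr rfl fun n₁ _ => sum_congr rfl fun n₂ _ => ?_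
  rw [mul_sum, mul_sum]
  refine sum_congr rfl fun s _ => ?_
  rw [othersPMF]
  ring

/-- For `s` successes, min(s, M - 1) is the number of slots α with 2 ≤ α ≤ min(s + 1, M); exchange
the sums over `s` and α. -/
lemma pS_eq_sum_phi (N M V : ℕ) (ρ γ : ℝ) :
    pS N M V ρ γ = ∑ α ∈ Icc 2 M, phi N M V ρ γ α := by
  simp only [phi, pS]
  rw [sum_comm]
  refine sum_congr rfl fun n₁ _ => ?_
  rw [sum_comm]
  refine sum_congr rfl fun n₂ _ => ?_
  rw [sum_comm' (t' := Icc 1 (min V (n₂ + 1))) (s' := fun s => Icc 2 (min (s + 1) M))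
    (by intro x y; simp only [mem_Icc]; omega)]
  refine sum_congr rfl fun s hs => ?_
  have : min (s + 1) M + 1 - 2 = min s (M - 1) := by
    have := (mem_Icc.1 hs).1
    omega
  rw [sum_const, Nat.card_Icc, this, nsmul_eq_mul]
  ring

/-- Averaging over independent users: each has a state in `Y` with weight `w`, it reserves if
`flag` holds, in the mini-slot `mini`. -/
lemma sum_prod_weight_singleRank {ι : Type*} [Fintype ι] [DecidableEq ι] {V : ℕ} (hV : 1 ≤ V)
    {Y : Type*} [Fintype Y] (flag : Y → Bool) (mini : Y → Fin V) (w F : Y → ℝ) (θ c : ℝ)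
    (h1 : ∀ v, ∑ y with flag y = true ∧ mini y = v, w y = θ / V)
    (h0 : ∀ v, ∑ y with flag y = false ∧ mini y = v, w y = (1 - θ) / V)
    (hc : ∀ v, ∑ y with flag y = true ∧ mini y = v, w y * F y = c / V) (n : ι) (j : ℕ) :
    ∑ z : ι → Y, (∏ m, w (z m)) *
        (if n ∈ singles (univ.filter fun m => flag (z m) = true) (fun m => mini (z m)) ∧
          singleRank (univ.filter fun m => flag (z m) = true) (fun m => mini (z m)) n = j
          then F (z n) else 0) =
      c * ∑ r ∈ range (Fintype.card ι - 1 + 1), ((Fintype.card ι - 1).choose r : ℝ) *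
        (θ ^ r * (1 - θ) ^ (Fintype.card ι - 1 - r)) *
        ((1 / ((r : ℝ) + 1)) * ∑ s ∈ Icc (j + 1) (min V (r + 1)), singlePMF V (r + 1) s) := by
  have hV0 : (V : ℝ) ≠ 0 := by positivity
  set L := Fintype.card ι - 1 with hL
  have hcard : Fintype.card ι = L + 1 := by
    have : 0 < Fintype.card ι := Fintype.card_pos_iff.2 ⟨n⟩
    omega
  -- With `R` and `f` prescribed, the sum splits into one factor per user: c/V for `n`, θ/V for the
  -- other members of `R`, and (1 - θ)/V outside `R`.
  have hfiber : ∀ (R : Finset ι) (f : ι → Fin V), n ∈ R →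
      ∑ z : ι → Y with (univ.filter (fun m => flag (z m) = true), fun m => mini (z m)) = (R, f),
        (∏ m, w (z m)) * F (z n) =
      c * (θ ^ (R.erase n).card * (1 - θ) ^ (L - (R.erase n).card)) / (V : ℝ) ^ Fintype.card ι := by
    intro R f hnR
    have hset : (univ.filter fun z : ι → Y =>
        (univ.filter (fun m => flag (z m) = true), fun m => mini (z m)) = (R, f)) =
        Fintype.piFinset fun m =>
          univ.filter fun y => flag y = decide (m ∈ R) ∧ mini y = f m := by
      ext z
      simp only [mem_filter, mem_univ, true_and, Prod.mk.injEq, Fintype.mem_piFinset,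
        forall_and]
      refine and_congr ?_ ?_
      · rw [Finset.ext_iff]
        refine forall_congr' fun m => ?_
        simp only [mem_filter, mem_univ, true_and]
        by_cases hm : m ∈ R <;> simp [hm]
      · exact funext_iff
    have hprod : ∀ z : ι → Y, (∏ m, w (z m)) * F (z n) =
        ∏ m, (w (z m) * if m = n then F (z m) else 1) := by
      intro z
      rw [prod_mul_distrib, prod_ite_eq' univ n]
      simp
    rw [hset, sum_congr rfl fun z _ => hprod z,
      ← prod_univ_sum (fun m => univ.filter fun y => flag y = decide (m ∈ R) ∧ mini y = f m)
        (fun m y => w y * if m = n then F y else 1)]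
    have hterm : ∀ m, (∑ y with flag y = decide (m ∈ R) ∧ mini y = f m,
        w y * (if m = n then F y else 1)) =
        (if m = n then c else 1) * (if m ∈ R.erase n then θ else 1) *
          (if m ∈ Rᶜ then 1 - θ else 1) * (V : ℝ)⁻¹ := by
      intro m
      by_cases hmn : m = n
      · subst hmn
        simp [hnR, hc, div_eq_mul_inv]
      · by_cases hmR : m ∈ R
        · simp [hmn, hmR, h1, div_eq_mul_inv]
        · simp [hmn, hmR, h0, div_eq_mul_inv]
    have hcc : Fintype.card ι - R.card = L - (R.erase n).card := by
      rw [card_erase_of_mem hnR, hcard]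
      have := card_pos.2 ⟨n, hnR⟩
      omega
    rw [prod_congr rfl fun m _ => hterm m, prod_mul_distrib, prod_mul_distrib, prod_mul_distrib,
      prod_ite_mem, prod_ite_mem, prod_ite_eq' univ n]
    simp [card_compl, hcc, div_eq_mul_inv, mul_assoc]
  -- Success and rank depend on `z` only through `(R, f)`, so the sum is organised by the fibres of
  -- that map.
  have hmain : ∑ z : ι → Y, (∏ m, w (z m)) *
        (if n ∈ singles (univ.filter fun m => flag (z m) = true) (fun m => mini (z m)) ∧
          singleRank (univ.filter fun m => flag (z m) = true) (fun m => mini (z m)) n = j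
          then F (z n) else 0) =
      ∑ R : Finset ι, ∑ f : ι → Fin V, if n ∈ singles R f ∧ singleRank R f n = j then
        c * (θ ^ (R.erase n).card * (1 - θ) ^ (L - (R.erase n).card)) / (V : ℝ) ^ Fintype.card ι
        else 0 := by
    rw [← Fintype.sum_prod_type', ← sum_fiberwise univ (fun z : ι → Y =>
      (univ.filter (fun m => flag (z m) = true), fun m => mini (z m)))]
    refine sum_congr rfl fun Rf _ => ?_
    obtain ⟨R, f⟩ := Rf
    have : ∀ z ∈ univ.filter (fun z : ι → Y =>
        (univ.filter (fun m => flag (z m) = true), fun m => mini (z m)) = (R, f)),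
        (∏ m, w (z m)) *
        (if n ∈ singles (univ.filter fun m => flag (z m) = true) (fun m => mini (z m)) ∧
          singleRank (univ.filter fun m => flag (z m) = true) (fun m => mini (z m)) n = j
          then F (z n) else 0) =
        if n ∈ singles R f ∧ singleRank R f n = j then (∏ m, w (z m)) * F (z n) else 0 := by
      intro z hz
      simp only [mem_filter, mem_univ, true_and, Prod.mk.injEq] at hz
      rw [hz.1, hz.2, mul_ite, mul_zero]
    rw [sum_congr rfl this]
    by_cases h : n ∈ singles R f ∧ singleRank R f n = j
    · rw [if_pos h, sum_congr rfl fun z _ => if_pos h]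
      exact hfiber R f (singles_subset R f h.1)
    · rw [if_neg h, sum_congr rfl fun z _ => if_neg h, sum_const_zero]
  rw [hmain]
  have hinner : ∀ R : Finset ι, (∑ f : ι → Fin V, if n ∈ singles R f ∧ singleRank R f n = j then
        c * (θ ^ (R.erase n).card * (1 - θ) ^ (L - (R.erase n).card)) / (V : ℝ) ^ Fintype.card ι
        else 0) = if n ∈ R then
          c * ((θ ^ (R.erase n).card * (1 - θ) ^ (L - (R.erase n).card)) *
          ((1 / (((R.erase n).card : ℝ) + 1)) *
            ∑ s ∈ Icc (j + 1) (min V ((R.erase n).card + 1)),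
              singlePMF V ((R.erase n).card + 1) s)) else 0 := by
    intro R
    rw [← sum_filter, sum_const, nsmul_eq_mul]
    split_ifs with hn
    · rw [card_singleRank_eq hV R hn j, ← card_erase_add_one hn, Nat.cast_add_one,
        mul_div_assoc', mul_assoc, mul_div_cancel_left₀ _ (pow_ne_zero _ hV0)]
      ring
    · rw [filter_eq_empty_iff.2]
      · simp
      · intro f _ h
        exact hn (singles_subset R f h.1)
  rw [sum_congr rfl fun R _ => hinner R, ← sum_filter]
  -- Removing `n` leaves an arbitrary set of other users, and the summand sees only its size; this
  -- is where the binomial law appears.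
  have hbij : ∑ R : Finset ι with n ∈ R,
        c * ((θ ^ (R.erase n).card * (1 - θ) ^ (L - (R.erase n).card)) *
          ((1 / (((R.erase n).card : ℝ) + 1)) *
            ∑ s ∈ Icc (j + 1) (min V ((R.erase n).card + 1)),
              singlePMF V ((R.erase n).card + 1) s)) =
      ∑ S ∈ (univ.erase n).powerset,
        c * ((θ ^ S.card * (1 - θ) ^ (L - S.card)) *
          ((1 / ((S.card : ℝ) + 1)) *
            ∑ s ∈ Icc (j + 1) (min V (S.card + 1)), singlePMF V (S.card + 1) s)) := by
    refine sum_bij' (fun R _ => R.erase n) (fun S _ => insert n S) ?_ ?_ ?_ ?_ ?_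
    · intro R _
      exact mem_powerset.2 (erase_subset_erase _ (subset_univ _))
    · intro S _
      simp
    · intro R hR
      exact insert_erase (mem_filter.1 hR).2
    · intro S hS
      exact erase_insert fun h => by simpa using mem_powerset.1 hS h
    · intro R _
      rfl
  rw [hbij, sum_powerset_apply_card (fun k => c * ((θ ^ k * (1 - θ) ^ (L - k)) *
          ((1 / ((k : ℝ) + 1)) *
            ∑ s ∈ Icc (j + 1) (min V (k + 1)), singlePMF V (k + 1) s))),
    card_erase_of_mem (mem_univ n), card_univ, mul_sum]
  refine sum_congr rfl fun r _ => ?_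
  rw [nsmul_eq_mul]
  ring

/-! ### The choices that determine a frame -/

/-- The choices of one user which matter in a frame: its arrivals in the frame before, its coin
and its mini-slot. -/
abbrev UserFrame (M V : ℕ) : Type := (Fin M → Bool) × Bool × Fin V

variable {N M V : ℕ}

/-- Whether the user makes a reservation. -/
def UserFrame.flag (y : UserFrame M V) : Bool := decide (∃ t, y.1 t = true) && y.2.1

/-- The choices which matter in frame `k + 1`. -/
def frameOf (M : ℕ) (P : Path N V) (k : ℕ) : Fin N → UserFrame M V :=
  fun m => (fun t => P.arrival m (k * M + t), P.coin m (k + 1), P.mini m (k + 1))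

/-- The users making a reservation. -/
def reservers (z : Fin N → UserFrame M V) : Finset (Fin N) :=
  univ.filter fun m => (z m).flag = true

/-- User `n` is successful, after `j` other successful users. -/
def Served (z : Fin N → UserFrame M V) (n : Fin N) (j : ℕ) : Prop :=
  n ∈ singles (reservers z) (fun m => (z m).2.2) ∧
    singleRank (reservers z) (fun m => (z m).2.2) n = j

instance (z : Fin N → UserFrame M V) (n : Fin N) (j : ℕ) : Decidable (Served z n j) := by
  unfold Served; infer_instance

/-- The position in its frame of the last arrival. -/
def lastArrival (a : Fin M → Bool) : ℕ := (univ.filter fun t => a t = true).sup Fin.val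

lemma mem_freshArrivals_succ (hM : 0 < M) (P : Path N V) (n : Fin N) (k t : ℕ) :
    t ∈ freshArrivals M P n (k + 1) ↔
      ∃ s : Fin M, t = k * M + s ∧ P.arrival n (k * M + s) = true := by
  simp only [freshArrivals, mem_filter, mem_range, add_left_inj]
  constructor
  · rintro ⟨-, h, ha⟩
    have : t = k * M + t % M := by rw [← h, mul_comm]; exact (Nat.div_add_mod t M).symm
    exact ⟨⟨t % M, Nat.mod_lt _ hM⟩, this, by rw [← this]; exact ha⟩
  · rintro ⟨s, rfl, ha⟩
    refine ⟨?_, ?_, ha⟩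
    · rw [add_mul, one_mul]; omega
    · rw [mul_comm, Nat.mul_add_div hM, Nat.div_eq_of_lt s.2, add_zero]

lemma not_hasUpdate_zero (P : Path N V) (n : Fin N) : ¬ HasUpdate M P n 0 := by
  simp [HasUpdate, freshArrivals]

lemma hasUpdate_succ_iff (hM : 0 < M) (P : Path N V) (n : Fin N) (k : ℕ) :
    HasUpdate M P n (k + 1) ↔ ∃ t, (frameOf M P k n).1 t = true := by
  constructor
  · rintro ⟨t, ht⟩
    obtain ⟨s, -, hs⟩ := (mem_freshArrivals_succ hM P n k t).1 ht
    exact ⟨s, hs⟩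
  · rintro ⟨s, hs⟩
    exact ⟨_, (mem_freshArrivals_succ hM P n k _).2 ⟨s, rfl, hs⟩⟩

lemma reserves_succ_iff (hM : 0 < M) (P : Path N V) (n : Fin N) (k : ℕ) :
    Reserves M P n (k + 1) ↔ (frameOf M P k n).flag = true := by
  rw [Reserves, hasUpdate_succ_iff hM, UserFrame.flag, Bool.and_eq_true, decide_eq_true_iff]
  rfl

lemma mem_reservers_frameOf (hM : 0 < M) (P : Path N V) (n : Fin N) (k : ℕ) :
    n ∈ reservers (frameOf M P k) ↔ Reserves M P n (k + 1) := by
  simp [reservers, reserves_succ_iff hM]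

lemma reservationSucceeds_succ_iff (hM : 0 < M) (P : Path N V) (n : Fin N) (k : ℕ) :
    ReservationSucceeds M P n (k + 1) ↔
      n ∈ singles (reservers (frameOf M P k)) (fun m => (frameOf M P k m).2.2) := by
  simp only [mem_singles, mem_reservers_frameOf hM]
  exact and_congr_right fun _ => forall_congr' fun m =>
    ⟨fun h h1 h2 => h h2 h1, fun h h1 h2 => h h2 h1⟩

lemma rank_succ (hM : 0 < M) (P : Path N V) (n : Fin N) (k : ℕ) :
    rank M P n (k + 1) =
      singleRank (reservers (frameOf M P k)) (fun m => (frameOf M P k m).2.2) n := by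
  classical
  unfold rank singleRank
  congr 1
  ext m
  simp only [mem_filter, mem_univ, true_and, reservationSucceeds_succ_iff hM]
  rfl

/-- Rank `j` means data slot `j + 1`. Index `k` of `frameOf` stands for frame `k + 1`, since frame 0
serves nobody. -/
lemma received_iff_served (hM : 0 < M) (P : Path N V) (n : Fin N) (k : ℕ) {j : ℕ}
    (hj : j + 1 < M) :
    Received M P n ((k + 1) * M + (j + 1)) ↔ Served (frameOf M P k) n j := by
  have h1 : ((k + 1) * M + (j + 1)) / M = k + 1 := by
    rw [mul_comm, Nat.mul_add_div hM, Nat.div_eq_of_lt hj, add_zero]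
  have h2 : ((k + 1) * M + (j + 1)) % M = j + 1 := by
    rw [mul_comm, Nat.mul_add_mod, Nat.mod_eq_of_lt hj]
  rw [Received, h1, h2, reservationSucceeds_succ_iff hM, rank_succ hM, Served]
  exact and_congr_right fun _ => ⟨fun h => by omega, fun h => by omega⟩

lemma not_received_frame_start (P : Path N V) (n : Fin N) (k : ℕ) :
    ¬ Received M P n (k * M) := by
  intro h
  have := h.2
  simp at this

lemma not_received_of_lt (P : Path N V) (n : Fin N) {t : ℕ} (ht : t < M) :
    ¬ Received M P n t := by
  intro h
  have := h.1.1.1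
  rw [Nat.div_eq_of_lt ht] at this
  exact not_hasUpdate_zero P n this

lemma Served.exists_arrival {z : Fin N → UserFrame M V} {n : Fin N} {j : ℕ} (h : Served z n j) :
    ∃ t, (z n).1 t = true := by
  have := singles_subset _ _ h.1
  simp only [reservers, mem_filter, mem_univ, true_and, UserFrame.flag, Bool.and_eq_true,
    decide_eq_true_iff] at this
  exact this.1

lemma genTime_succ (hM : 0 < M) (P : Path N V) (n : Fin N) (k : ℕ)
    (h : ∃ t, (frameOf M P k n).1 t = true) :
    genTime M P n (k + 1) = k * M + lastArrival (frameOf M P k n).1 := by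
  obtain ⟨t, ht⟩ := h
  refine le_antisymm (Finset.sup_le fun x hx => ?_) ?_
  · obtain ⟨s, rfl, hs⟩ := (mem_freshArrivals_succ hM P n k x).1 hx
    refine Nat.add_le_add_left ?_ _
    exact Finset.le_sup (f := Fin.val) (mem_filter.2 ⟨mem_univ s, hs⟩)
  · obtain ⟨s, hs, hs'⟩ := exists_mem_eq_sup (univ.filter fun t => (frameOf M P k n).1 t = true)
      ⟨t, by simpa using ht⟩ Fin.val
    rw [lastArrival, hs']
    exact Finset.le_sup (f := id) ((mem_freshArrivals_succ hM P n k _).2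
      ⟨s, rfl, (mem_filter.1 hs).2⟩)

lemma lastArrival_lt (hM : 0 < M) (a : Fin M → Bool) : lastArrival a < M :=
  (Finset.sup_lt_iff hM).2 fun t _ => t.2

lemma receivedInFrame_succ_iff (hM : 0 < M) (P : Path N V) (n : Fin N) (k : ℕ) :
    ReceivedInFrame M P n (k + 1) ↔ ∃ j ∈ range (M - 1), Served (frameOf M P k) n j := by
  constructor
  · rintro ⟨t, ht, h⟩
    have hmod := h.2
    have hlt := Nat.mod_lt t hM
    have ht' : t = (k + 1) * M + (rank M P n (t / M) + 1) := by
      rw [← hmod, ← ht, mul_comm]; exact (Nat.div_add_mod t M).symm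
    rw [hmod] at hlt
    refine ⟨rank M P n (t / M), mem_range.2 (by omega), ?_⟩
    rw [← received_iff_served hM P n k hlt, ← ht']
    exact h
  · rintro ⟨j, hj, h⟩
    have hj' : j + 1 < M := by have := mem_range.1 hj; omega
    refine ⟨(k + 1) * M + (j + 1), ?_, (received_iff_served hM P n k hj').2 h⟩
    rw [mul_comm, Nat.mul_add_div hM, Nat.div_eq_of_lt hj', add_zero]

/-! ### The law of a frame -/

/-- The weights of a Bernoulli variable. -/
noncomputable def bern (x : ℝ) (b : Bool) : ℝ := if b = true then x else 1 - x

/-- The probability of the choices of one user in one frame. -/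
noncomputable def userWeight (ρ γ : ℝ) (y : UserFrame M V) : ℝ :=
  (∏ t, bern ρ (y.1 t)) * bern γ y.2.1 * (1 / (V : ℝ))

/-- The basic random variables entering frame `k + 1`. -/
def sourceOf (N M : ℕ) : ℕ × Fin N × (Fin M ⊕ Bool) → Source N
  | (k, m, .inl t) => .arrival m (k * M + t)
  | (k, m, .inr true) => .coin m (k + 1)
  | (k, m, .inr false) => .mini m (k + 1)

/-- Arrival slots in different frames differ by uniqueness of Euclidean division. Injectivity is
what turns independence of the basic variables into independence of the frames: no variable enters
two of them. -/
lemma sourceOf_injective : Function.Injective (sourceOf N M) := by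
  rintro ⟨k, m, t | _ | _⟩ ⟨k', m', t' | _ | _⟩ h <;>
    simp only [sourceOf, Source.arrival.injEq, Source.coin.injEq, Source.mini.injEq,
      reduceCtorEq, add_left_inj] at h
  · have hM : 0 < M := t.pos
    have h1 : k = k' := by
      have := congrArg (· / M) h.2
      simpa [mul_comm _ M, Nat.mul_add_div hM, Nat.div_eq_of_lt t.2, Nat.div_eq_of_lt t'.2]
        using this
    obtain ⟨rfl, h2⟩ := h
    subst h1
    have : t = t' := Fin.ext (by omega)
    rw [this]
  · rw [h.1, h.2]
  · rw [h.1, h.2]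

/-- The value which the choices `z` prescribe for a basic random variable. -/
def sourceValue (z : Fin N → UserFrame M V) :
    (i : ℕ × Fin N × (Fin M ⊕ Bool)) → (sourceOf N M i).Value V
  | (_, m, .inl t) => (z m).1 t
  | (_, m, .inr true) => (z m).2.1
  | (_, m, .inr false) => (z m).2.2

instance (s : Source N) : DiscreteMeasurableSpace (s.Value V) := ⟨fun _ => trivial⟩

instance (s : Source N) : Finite (s.Value V) := by
  cases s <;> unfold Source.Value <;> infer_instance

section Law

variable {Ω : Type*} [MeasurableSpace Ω] {μ : Measure Ω} {ρ γ : ℝ}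
  {P : Ω → Path N V}

lemma frameOf_eq_iff (P : Path N V) (k : ℕ) (z : Fin N → UserFrame M V) :
    frameOf M P k = z ↔ (∀ m (t : Fin M), P.arrival m (k * M + t) = (z m).1 t) ∧
      (∀ m, P.coin m (k + 1) = (z m).2.1) ∧ ∀ m, P.mini m (k + 1) = (z m).2.2 := by
  simp only [frameOf, funext_iff, Prod.ext_iff, forall_and]

lemma IsNetwork.measureReal_arrival [IsProbabilityMeasure μ] (hP : IsNetwork μ ρ γ P)
    (n : Fin N) (t : ℕ) (b : Bool) :
    μ.real {ω | (P ω).arrival n t = b} = bern ρ b := by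
  cases b with
  | true => simpa [bern] using hP.arrival_law n t
  | false =>
    have hm : MeasurableSet {ω | (P ω).arrival n t = true} :=
      hP.measurable (.arrival n t) (MeasurableSet.of_discrete (s := {(true : Bool)}))
    have := probReal_compl_eq_one_sub (μ := μ) hm
    rw [hP.arrival_law] at this
    rw [bern, if_neg Bool.false_ne_true, ← this]
    congr 1
    ext ω
    simp

lemma IsNetwork.measureReal_coin [IsProbabilityMeasure μ] (hP : IsNetwork μ ρ γ P)
    (n : Fin N) (k : ℕ) (b : Bool) :
    μ.real {ω | (P ω).coin n k = b} = bern γ b := by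
  cases b with
  | true => simpa [bern] using hP.coin_law n k
  | false =>
    have hm : MeasurableSet {ω | (P ω).coin n k = true} :=
      hP.measurable (.coin n k) (MeasurableSet.of_discrete (s := {(true : Bool)}))
    have := probReal_compl_eq_one_sub (μ := μ) hm
    rw [hP.coin_law] at this
    rw [bern, if_neg Bool.false_ne_true, ← this]
    congr 1
    ext ω
    simp

lemma IsNetwork.measurable_frameOf (hP : IsNetwork μ ρ γ P) (k : ℕ) :
    Measurable fun ω => frameOf M (P ω) k := by
  refine measurable_pi_lambda _ fun m => ?_
  refine Measurable.prodMk (measurable_pi_lambda _ fun t => ?_) (Measurable.prodMk ?_ ?_)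
  · have := hP.measurable (.arrival m (k * M + t))
    intro s _
    exact this (MeasurableSet.of_discrete (s := (s : Set Bool)))
  · have := hP.measurable (.coin m (k + 1))
    intro s _
    exact this (MeasurableSet.of_discrete (s := (s : Set Bool)))
  · have := hP.measurable (.mini m (k + 1))
    intro s _
    exact this (MeasurableSet.of_discrete (s := (s : Set (Fin V))))

/-- The choices of the users in a frame are independent, with the same law in every frame. -/
lemma IsNetwork.measureReal_frameOf [IsProbabilityMeasure μ] (hP : IsNetwork μ ρ γ P)
    (k : ℕ) (z : Fin N → UserFrame M V) :
    μ.real {ω | frameOf M (P ω) k = z} = ∏ m, userWeight ρ γ (z m) := by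
  have h := (hP.indep.precomp (sourceOf_injective (N := N) (M := M))).measure_inter_preimage_eq_mul
    ({k} ×ˢ univ) (sets := fun i => {sourceValue z i}) (fun i _ => MeasurableSet.of_discrete)
  have hset : (⋂ i ∈ ({k} ×ˢ univ : Finset (ℕ × Fin N × (Fin M ⊕ Bool))),
      family P (sourceOf N M i) ⁻¹' {sourceValue z i}) = {ω | frameOf M (P ω) k = z} := by
    ext ω
    simp only [Set.mem_iInter, mem_product, mem_singleton, mem_univ, and_true, Set.mem_preimage,
      Set.mem_singleton_iff, Set.mem_ofPred_eq, frameOf_eq_iff]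
    constructor
    · intro h
      exact ⟨fun m t => h (k, m, .inl t) rfl, fun m => h (k, m, .inr true) rfl,
        fun m => h (k, m, .inr false) rfl⟩
    · rintro ⟨h1, h2, h3⟩ ⟨_, m, t | _ | _⟩ rfl
      · exact h1 m t
      · exact h3 m
      · exact h2 m
  rw [hset] at h
  rw [measureReal_def, h, ENNReal.toReal_prod, prod_product, prod_singleton,
    Fintype.prod_prod_type]
  refine prod_congr rfl fun m _ => ?_
  rw [Fintype.prod_sum_type, Fintype.prod_bool, userWeight, ← mul_assoc]
  refine congrArg₂ _ (congrArg₂ _ (prod_congr rfl fun t _ => ?_) ?_) ?_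
  · exact hP.measureReal_arrival m (k * M + t) ((z m).1 t)
  · exact hP.measureReal_coin m (k + 1) (z m).2.1
  · exact hP.mini_law m (k + 1) (z m).2.2

lemma IsNetwork.integral_frameOf [IsProbabilityMeasure μ] (hP : IsNetwork μ ρ γ P)
    (k : ℕ) (G : (Fin N → UserFrame M V) → ℝ) :
    ∫ ω, G (frameOf M (P ω) k) ∂μ = ∑ z, (∏ m, userWeight ρ γ (z m)) * G z := by
  have hm := hP.measurable_frameOf (M := M) k
  have := Measure.isProbabilityMeasure_map (μ := μ) hm.aemeasurable
  rw [← integral_map (φ := fun ω => frameOf M (P ω) k) hm.aemeasurable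
    (Measurable.of_discrete (f := G)).aestronglyMeasurable, integral_fintype .of_finite]
  refine sum_congr rfl fun z _ => ?_
  rw [map_measureReal_apply hm (measurableSet_singleton z), smul_eq_mul,
    ← hP.measureReal_frameOf k z]
  rfl

/-- The frames are independent of the past. -/
lemma IsNetwork.indepFun_frameOf (hP : IsNetwork μ ρ γ P) (k : ℕ) :
    IndepFun (fun ω (i : Fin k) => frameOf M (P ω) i) (fun ω => frameOf M (P ω) k) μ := by
  have h := iIndepFun.indepFun_finset (range k ×ˢ univ) ({k} ×ˢ univ)
    (by
      rw [Finset.disjoint_left]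
      rintro ⟨a, b⟩ h1 h2
      simp only [mem_product, mem_range, mem_singleton] at h1 h2
      omega)
    (hP.indep.precomp (sourceOf_injective (N := N) (M := M))) (fun i => hP.measurable _)
  -- `φ` and `ψ` reassemble the past frames and the present one from two disjoint blocks of basic
  -- variables.
  let φ : ((i : (range k ×ˢ univ : Finset (ℕ × Fin N × (Fin M ⊕ Bool)))) →
      (sourceOf N M i).Value V) → (Fin k → Fin N → UserFrame M V) := fun x i m =>
    (fun t => x ⟨(i, m, .inl t), by simp⟩, x ⟨(i, m, .inr true), by simp⟩,
      x ⟨(i, m, .inr false), by simp⟩)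
  let ψ : ((i : ({k} ×ˢ univ : Finset (ℕ × Fin N × (Fin M ⊕ Bool)))) →
      (sourceOf N M i).Value V) → (Fin N → UserFrame M V) := fun x m =>
    (fun t => x ⟨(k, m, .inl t), by simp⟩, x ⟨(k, m, .inr true), by simp⟩,
      x ⟨(k, m, .inr false), by simp⟩)
  exact h.comp (φ := φ) (ψ := ψ) (Measurable.of_discrete) (Measurable.of_discrete)

end Law

/-! ### Averages over a frame -/

lemma sum_bern (x : ℝ) : ∑ b, bern x b = 1 := by
  simp [bern]

lemma sum_prod_bern (M : ℕ) (ρ : ℝ) : ∑ a : Fin M → Bool, ∏ t, bern ρ (a t) = 1 := by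
  have := prod_univ_sum (fun _ : Fin M => (univ : Finset Bool)) (fun _ b => bern ρ b)
  simp only [Fintype.piFinset_univ, sum_bern, prod_const_one] at this
  exact this.symm

/-- The mean of `F` over the frames of arrivals that are not empty. -/
noncomputable def arrivalMean (ρ : ℝ) (F : (Fin M → Bool) → ℝ) : ℝ :=
  ∑ a with ∃ t, a t = true, (∏ t, bern ρ (a t)) * F a

lemma arrivalMean_one (M : ℕ) (ρ : ℝ) :
    arrivalMean ρ (fun _ : Fin M → Bool => 1) = pUpdate M ρ := by
  have h := sum_filter_add_sum_filter_not univ (fun a : Fin M → Bool => ∃ t, a t = true)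
    (fun a => ∏ t, bern ρ (a t))
  rw [sum_prod_bern] at h
  have h2 : (univ.filter fun a : Fin M → Bool => ¬ ∃ t, a t = true) = {fun _ => false} := by
    ext a
    simp [funext_iff]
  rw [h2, sum_singleton] at h
  simp only [bern, Bool.false_eq_true, if_false, prod_const, card_univ, Fintype.card_fin] at h
  simp only [arrivalMean, mul_one, pUpdate, bern]
  linarith

/-- The mini-slot is uniform and independent of arrivals and coin, so the value does not depend on
`v`, as `sum_prod_weight_singleRank` requires. -/
lemma sum_userWeight_mul (ρ γ : ℝ) (F : (Fin M → Bool) → ℝ) (v : Fin V) :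
    ∑ y : UserFrame M V with y.flag = true ∧ y.2.2 = v, userWeight ρ γ y * F y.1 =
      γ * arrivalMean ρ F / V := by
  rw [sum_filter, Fintype.sum_prod_type, arrivalMean, sum_filter, mul_sum, sum_div]
  refine sum_congr rfl fun a _ => ?_
  rw [Fintype.sum_prod_type, Fintype.sum_bool]
  by_cases ha : ∃ t, a t = true
  · simp [UserFrame.flag, ha, userWeight, bern]
    ring
  · simp [UserFrame.flag, ha]

lemma sum_userWeight_mini (ρ γ : ℝ) (v : Fin V) :
    ∑ y : UserFrame M V with y.2.2 = v, userWeight ρ γ y = 1 / V := by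
  rw [sum_filter, Fintype.sum_prod_type]
  have : ∀ a : Fin M → Bool, (∑ y : Bool × Fin V, if y.2 = v then
      userWeight ρ γ ((a, y) : UserFrame M V) else 0) = (∏ t, bern ρ (a t)) * (1 / V) := by
    intro a
    rw [Fintype.sum_prod_type, Fintype.sum_bool]
    simp [userWeight, bern]
    ring
  rw [sum_congr rfl fun a _ => this a, ← sum_mul, sum_prod_bern, one_mul]

lemma sum_userWeight_not_flag (ρ γ : ℝ) (v : Fin V) :
    ∑ y : UserFrame M V with y.flag = false ∧ y.2.2 = v, userWeight ρ γ y =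
      (1 - pUpdate M ρ * γ) / V := by
  have h1 := sum_userWeight_mul ρ γ (fun _ : Fin M → Bool => (1 : ℝ)) v
  rw [arrivalMean_one] at h1
  simp only [mul_one] at h1
  have h3 := sum_filter_add_sum_filter_not (univ.filter fun y : UserFrame M V => y.2.2 = v)
    (fun y => y.flag = true) (userWeight ρ γ)
  simp only [filter_filter, Bool.not_eq_true] at h3
  rw [sum_userWeight_mini, filter_congr (q := fun y : UserFrame M V => y.flag = true ∧ y.2.2 = v)
    (fun y _ => and_comm), h1, filter_congr (q := fun y : UserFrame M V =>
      y.flag = false ∧ y.2.2 = v) (fun y _ => and_comm)] at h3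
  rw [sub_div, mul_comm (pUpdate M ρ)]
  linarith

/-- The slot in which a user is served is independent of its arrivals, given that it reserves. -/
lemma sum_weight_served (hV : 1 ≤ V) (ρ γ : ℝ) (F : (Fin M → Bool) → ℝ) (n : Fin N) (j : ℕ) :
    ∑ z : Fin N → UserFrame M V, (∏ m, userWeight ρ γ (z m)) *
        (if Served z n j then F (z n).1 else 0) =
      γ * arrivalMean ρ F * phi N M V ρ γ (j + 2) := by
  have h := sum_prod_weight_singleRank hV (UserFrame.flag (M := M) (V := V)) (fun y => y.2.2)
    (userWeight ρ γ) (fun y => F y.1) (pUpdate M ρ * γ) (γ * arrivalMean ρ F)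
    (fun v => by
      have := sum_userWeight_mul ρ γ (fun _ : Fin M → Bool => (1 : ℝ)) v
      rw [arrivalMean_one] at this
      simpa [mul_comm] using this)
    (sum_userWeight_not_flag ρ γ) (sum_userWeight_mul ρ γ F) n j
  rw [Fintype.card_fin] at h
  rw [phi_eq_sum_binomial]
  exact h

lemma sum_weight_flag (hV : 1 ≤ V) (ρ γ : ℝ) (n : Fin N) :
    ∑ z : Fin N → UserFrame M V, (∏ m, userWeight ρ γ (z m)) *
        (if (z n).flag = true then 1 else 0) = pUpdate M ρ * γ := by
  have hV0 : (V : ℝ) ≠ 0 := by positivity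
  have h1 : ∑ y : UserFrame M V, userWeight ρ γ y * (if y.flag = true then 1 else 0) =
      pUpdate M ρ * γ := by
    have := fun v : Fin V => sum_userWeight_mul ρ γ (fun _ : Fin M → Bool => (1 : ℝ)) v
    simp only [arrivalMean_one, mul_one] at this
    simp only [mul_ite, mul_one, mul_zero]
    rw [← sum_filter, ← sum_fiberwise _ (fun y : UserFrame M V => y.2.2)]
    simp only [filter_filter, this, sum_const, card_univ, Fintype.card_fin, nsmul_eq_mul]
    field_simp
  have h0 : ∑ y : UserFrame M V, userWeight ρ γ y = 1 := by
    rw [← sum_fiberwise _ (fun y : UserFrame M V => y.2.2)]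
    simp only [sum_userWeight_mini, sum_const, card_univ, Fintype.card_fin, nsmul_eq_mul]
    field_simp
  have h2 : ∀ z : Fin N → UserFrame M V, (∏ m, userWeight ρ γ (z m)) *
      (if (z n).flag = true then 1 else 0) = ∏ m, (userWeight ρ γ (z m) *
        if m = n then (if (z m).flag = true then 1 else 0) else 1) := by
    intro z
    rw [prod_mul_distrib, prod_ite_eq' univ n]
    simp
  have h3 := prod_univ_sum (fun _ : Fin N => (univ : Finset (UserFrame M V))) (fun m y =>
    userWeight ρ γ y * if m = n then (if y.flag = true then 1 else 0) else 1)
  rw [Fintype.piFinset_univ] at h3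
  rw [sum_congr rfl fun z _ => h2 z, ← h3, ← mul_prod_erase univ _ (mem_univ n)]
  simp only [if_true, h1]
  rw [prod_eq_one, mul_one]
  intro m hm
  simp [(mem_erase.1 hm).1, h0]

/-! ### Positivity of the success probability. -/

lemma pUpdate_pos (hM : 0 < M) {ρ : ℝ} (hρ : 0 < ρ) (hρ1 : ρ ≤ 1) : 0 < pUpdate M ρ := by
  have : (1 - ρ) ^ M < 1 := pow_lt_one₀ (by linarith) (by linarith) hM.ne'
  rw [pUpdate]
  linarith

lemma bern_nonneg {x : ℝ} (h0 : 0 ≤ x) (h1 : x ≤ 1) (b : Bool) : 0 ≤ bern x b := by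
  unfold bern
  split_ifs <;> linarith

lemma userWeight_nonneg {ρ γ : ℝ} (hρ : 0 ≤ ρ) (hρ1 : ρ ≤ 1) (hγ : 0 ≤ γ) (hγ1 : γ ≤ 1)
    (y : UserFrame M V) : 0 ≤ userWeight ρ γ y :=
  mul_nonneg (mul_nonneg (prod_nonneg fun _ _ => bern_nonneg hρ hρ1 _) (bern_nonneg hγ hγ1 _))
    (by positivity)

/-- Outside the degenerate case, a given user may be the first to be served. -/
lemma exists_served (hM : 0 < M) (hV : 1 ≤ V) {ρ γ : ℝ} (hρ : 0 < ρ) (hρ1 : ρ ≤ 1)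
    (hγ : 0 < γ) (hγ1 : γ ≤ 1) (hne : ¬ (V = 1 ∧ 2 ≤ N ∧ ρ = 1 ∧ γ = 1)) (n : Fin N) :
    ∃ z : Fin N → UserFrame M V, (∀ m, 0 < userWeight ρ γ (z m)) ∧ Served z n 0 := by
  have hV0 : (0 : ℝ) < 1 / V := by positivity
  -- A common state for all other users that keeps mini-slot 0 free: no arrivals if ρ < 1, a
  -- declining coin if γ < 1, otherwise the last mini-slot. The last choice fails only for V = 1,
  -- where the excluded case leaves a single user.
  obtain ⟨y, hy, hy'⟩ : ∃ y : UserFrame M V, 0 < userWeight ρ γ y ∧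
      ((∀ m, m = n) ∨ y.flag = false ∨ y.2.2 ≠ ⟨0, hV⟩) := by
    rcases hρ1.lt_or_eq with hρ2 | hρ2
    · refine ⟨(fun _ => false, true, ⟨0, hV⟩), ?_, Or.inr (Or.inl ?_)⟩
      · have : 0 < 1 - ρ := by linarith
        simp only [userWeight, bern, Bool.false_eq_true, if_false, if_true, prod_const]
        positivity
      · simp [UserFrame.flag]
    rcases hγ1.lt_or_eq with hγ2 | hγ2
    · refine ⟨(fun _ => true, false, ⟨0, hV⟩), ?_, Or.inr (Or.inl ?_)⟩
      · have : 0 < 1 - γ := by linarith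
        simp only [userWeight, bern, Bool.false_eq_true, if_false, if_true, prod_const]
        positivity
      · simp [UserFrame.flag]
    refine ⟨(fun _ => true, true, ⟨V - 1, by omega⟩), ?_, ?_⟩
    · simp only [userWeight, bern, if_true, prod_const]
      positivity
    · by_cases hV1 : V = 1
      · left
        have hN : ¬ 2 ≤ N := fun h => hne ⟨hV1, h, hρ2, hγ2⟩
        intro m
        have := m.2
        have := n.2
        exact Fin.ext (by omega)
      · right; right
        simp only [ne_eq, Fin.mk.injEq]
        omega
  -- User `n` takes mini-slot 0, so no success can precede it.
  refine ⟨fun m => if m = n then (fun _ => true, true, ⟨0, hV⟩) else y, fun m => ?_, ?_, ?_⟩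
  · by_cases hm : m = n
    · simp only [hm, userWeight, bern, if_true, prod_const]
      positivity
    · simpa [hm] using hy
  · refine mem_singles.2 ⟨?_, fun m hm hmn => ?_⟩
    · refine mem_filter.2 ⟨mem_univ _, ?_⟩
      simp only [if_true, UserFrame.flag]
      rw [Bool.and_true, decide_eq_true_iff]
      exact ⟨⟨0, hM⟩, trivial⟩
    · simp only [reservers, mem_filter, mem_univ, true_and, if_neg hmn] at hm
      simp only [if_neg hmn, if_true]
      rcases hy' with h | h | h
      · exact absurd (h m) hmn
      · simp [h] at hm
      · exact h
  · rw [singleRank, card_eq_zero, filter_eq_empty_iff]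
    intro m _
    simp [Fin.lt_def]

/-- The closed form is an alternating sum; its sign is read off from the nonnegative sum over frames
that it evaluates. -/
lemma phi_nonneg (hM : 0 < M) (hV : 1 ≤ V) {ρ γ : ℝ} (hρ : 0 < ρ) (hρ1 : ρ ≤ 1)
    (hγ : 0 < γ) (hγ1 : γ ≤ 1) (n : Fin N) (j : ℕ) : 0 ≤ phi N M V ρ γ (j + 2) := by
  have h := sum_weight_served hV ρ γ (fun _ : Fin M → Bool => (1 : ℝ)) n j
  rw [arrivalMean_one] at h
  have hpos : 0 < γ * pUpdate M ρ := mul_pos hγ (pUpdate_pos hM hρ hρ1)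
  refine nonneg_of_mul_nonneg_right (a := γ * pUpdate M ρ) ?_ hpos
  rw [← h]
  refine sum_nonneg fun z _ => mul_nonneg (prod_nonneg fun m _ => ?_) ?_
  · exact userWeight_nonneg hρ.le hρ1 hγ.le hγ1 _
  · split_ifs <;> norm_num

/-- Already φ_2 is positive: some frame of positive weight serves the user first. -/
lemma pS_pos (hM : 2 ≤ M) (hV : 1 ≤ V) {ρ γ : ℝ} (hρ : 0 < ρ) (hρ1 : ρ ≤ 1)
    (hγ : 0 < γ) (hγ1 : γ ≤ 1) (hne : ¬ (V = 1 ∧ 2 ≤ N ∧ ρ = 1 ∧ γ = 1)) (n : Fin N) :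
    0 < pS N M V ρ γ := by
  have hM0 : 0 < M := by omega
  have h := sum_weight_served hV ρ γ (fun _ : Fin M → Bool => (1 : ℝ)) n 0
  rw [arrivalMean_one] at h
  have hpos : 0 < γ * pUpdate M ρ := mul_pos hγ (pUpdate_pos hM0 hρ hρ1)
  have hphi : 0 < phi N M V ρ γ 2 := by
    refine pos_of_mul_pos_right (a := γ * pUpdate M ρ) ?_ hpos.le
    rw [← h]
    obtain ⟨z, hz, hs⟩ := exists_served hM0 hV hρ hρ1 hγ hγ1 hne n
    refine sum_pos' (fun z _ => mul_nonneg (prod_nonneg fun m _ => ?_) ?_) ⟨z, mem_univ z, ?_⟩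
    · exact userWeight_nonneg hρ.le hρ1 hγ.le hγ1 _
    · split_ifs <;> norm_num
    · rw [if_pos hs, mul_one]
      exact prod_pos fun m _ => hz m
  rw [pS_eq_sum_phi]
  refine sum_pos' (fun α hα => ?_) ⟨2, by simpa using hM, hphi⟩
  obtain ⟨j, rfl⟩ := Nat.exists_eq_add_of_le' (mem_Icc.1 hα).1
  exact phi_nonneg hM0 hV hρ hρ1 hγ hγ1 n j

/-! ### Conditional probabilities of reception. -/

section Law

variable {Ω : Type*} [MeasurableSpace Ω] {μ : Measure Ω} {ρ γ : ℝ}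
  {P : Ω → Path N V}

lemma IsNetwork.integral_served [IsProbabilityMeasure μ]
    (hP : IsNetwork μ ρ γ P) (hV : 1 ≤ V) (k : ℕ)
    (F : (Fin M → Bool) → ℝ) (n : Fin N) (j : ℕ) :
    ∫ ω, (if Served (frameOf M (P ω) k) n j then F (frameOf M (P ω) k n).1 else 0) ∂μ =
      γ * arrivalMean ρ F * phi N M V ρ γ (j + 2) := by
  rw [← sum_weight_served hV ρ γ F n j]
  exact hP.integral_frameOf k fun z => if Served z n j then F (z n).1 else 0

lemma IsNetwork.measureReal_reserves [IsProbabilityMeasure μ]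
    (hP : IsNetwork μ ρ γ P) (hM : 0 < M) (hV : 1 ≤ V) (k : ℕ) (n : Fin N) : μ.real {ω | Reserves M (P ω) n (k + 1)} = pUpdate M ρ * γ := by
  rw [← sum_weight_flag hV ρ γ n,
    ← hP.integral_frameOf k fun z => if (z n).flag = true then 1 else 0]
  have hs : MeasurableSet {ω | (frameOf M (P ω) k n).flag = true} :=
    (hP.measurable_frameOf k) (MeasurableSet.of_discrete
      (s := {z : Fin N → UserFrame M V | (z n).flag = true}))
  have := integral_indicator_one (μ := μ) hs
  simp only [reserves_succ_iff hM]
  rw [← this]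
  refine integral_congr_ae (.of_forall fun ω => ?_)
  simp [Set.indicator_apply]

lemma IsNetwork.measureReal_served [IsProbabilityMeasure μ]
    (hP : IsNetwork μ ρ γ P) (hV : 1 ≤ V) (k : ℕ)
    (n : Fin N) (j : ℕ) :
    μ.real {ω | Served (frameOf M (P ω) k) n j} =
      pUpdate M ρ * γ * phi N M V ρ γ (j + 2) := by
  have h := hP.integral_served hV k (fun _ : Fin M → Bool => (1 : ℝ)) n j
  rw [arrivalMean_one] at h
  rw [mul_comm (pUpdate M ρ), ← h]
  have hs : MeasurableSet {ω | Served (frameOf M (P ω) k) n j} :=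
    (hP.measurable_frameOf k) (MeasurableSet.of_discrete
      (s := {z : Fin N → UserFrame M V | Served z n j}))
  rw [← integral_indicator_one (μ := μ) hs]
  refine integral_congr_ae (.of_forall fun ω => ?_)
  simp [Set.indicator_apply]

lemma Served.reserves (hM : 0 < M) {P : Path N V} {k j : ℕ} {n : Fin N}
    (h : Served (frameOf M P k) n j) : Reserves M P n (k + 1) :=
  (mem_reservers_frameOf hM P n k).1 (singles_subset _ _ h.1)

lemma IsNetwork.measurableSet_reserves (hP : IsNetwork μ ρ γ P) (hM : 0 < M) (k : ℕ)
    (n : Fin N) : MeasurableSet {ω | Reserves M (P ω) n (k + 1)} := by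
  simp only [reserves_succ_iff hM]
  exact (hP.measurable_frameOf k) (MeasurableSet.of_discrete
      (s := {z : Fin N → UserFrame M V | (z n).flag = true}))

lemma measureReal_cond (μ : Measure Ω) {s : Set Ω} (hs : MeasurableSet s) (t : Set Ω) :
    (cond μ s).real t = (μ.real s)⁻¹ * μ.real (s ∩ t) := by
  rw [measureReal_def, cond_apply hs, ENNReal.toReal_mul, ENNReal.toReal_inv]
  rfl

lemma IsNetwork.cond_received [IsProbabilityMeasure μ]
    (hP : IsNetwork μ ρ γ P) (hM : 0 < M) (hV : 1 ≤ V)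
    (hρ : 0 < ρ) (hρ1 : ρ ≤ 1) (hγ : 0 < γ) (k : ℕ) (n : Fin N) {j : ℕ} (hj : j + 1 < M) :
    (cond μ {ω | Reserves M (P ω) n (k + 1)}).real
      {ω | Received M (P ω) n ((k + 1) * M + (j + 1))} = phi N M V ρ γ (j + 2) := by
  have hpos : 0 < pUpdate M ρ * γ := mul_pos (pUpdate_pos hM hρ hρ1) hγ
  rw [measureReal_cond μ (hP.measurableSet_reserves hM k n), hP.measureReal_reserves hM hV]
  have : {ω | Reserves M (P ω) n (k + 1)} ∩ {ω | Received M (P ω) n ((k + 1) * M + (j + 1))} =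
      {ω | Served (frameOf M (P ω) k) n j} := by
    ext ω
    simp only [Set.mem_inter_iff, Set.mem_ofPred_eq, received_iff_served hM _ _ _ hj]
    exact ⟨fun h => h.2, fun h => ⟨h.reserves hM, h⟩⟩
  rw [this, hP.measureReal_served hV, ← mul_assoc, inv_mul_cancel₀ hpos.ne', one_mul]

lemma IsNetwork.cond_receivedInFrame [IsProbabilityMeasure μ]
    (hP : IsNetwork μ ρ γ P) (hM : 0 < M) (hV : 1 ≤ V)
    (hρ : 0 < ρ) (hρ1 : ρ ≤ 1) (hγ : 0 < γ) (k : ℕ) (n : Fin N) :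
    (cond μ {ω | Reserves M (P ω) n (k + 1)}).real
      {ω | ReceivedInFrame M (P ω) n (k + 1)} = pS N M V ρ γ := by
  have hpos : 0 < pUpdate M ρ * γ := mul_pos (pUpdate_pos hM hρ hρ1) hγ
  rw [measureReal_cond μ (hP.measurableSet_reserves hM k n), hP.measureReal_reserves hM hV]
  have : {ω | Reserves M (P ω) n (k + 1)} ∩ {ω | ReceivedInFrame M (P ω) n (k + 1)} =
      ⋃ j ∈ range (M - 1), {ω | Served (frameOf M (P ω) k) n j} := by
    ext ω
    simp only [Set.mem_inter_iff, Set.mem_ofPred_eq, receivedInFrame_succ_iff hM, Set.mem_iUnion,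
      exists_prop]
    exact ⟨fun h => h.2, fun h => ⟨h.choose_spec.2.reserves hM, h⟩⟩
  rw [this, measureReal_biUnion_finset]
  · simp only [hP.measureReal_served hV]
    rw [← mul_sum, pS_eq_sum_phi, ← mul_assoc, inv_mul_cancel₀ hpos.ne', one_mul]
    refine sum_bij' (fun j _ => j + 2) (fun α _ => α - 2) ?_ ?_ ?_ ?_ ?_ <;>
      intro x hx <;> simp only [mem_range, mem_Icc] at hx ⊢ <;> omega
  · intro i _ j _ hij
    rw [Function.onFun, Set.disjoint_left]
    intro ω hi hj
    exact hij (hi.2.symm.trans hj.2)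
  · intro j _
    exact (hP.measurable_frameOf k) (MeasurableSet.of_discrete
      (s := {z : Fin N → UserFrame M V | Served z n j}))

end Law

/-! ### Functionals of the past of a sequence -/

section Past

variable {S : Type*}

/-- Factoring through the first `k` coordinates brings the functional to a finite discrete space
when `S` is one, where measurability and integrability are automatic. -/
lemma exists_eq_comp_of_dependsOn [Nonempty S] {k : ℕ} {Φ : (ℕ → S) → ℝ}
    (hΦ : DependsOn Φ (Set.Iio k)) : ∃ g : (Fin k → S) → ℝ, ∀ x, Φ x = g fun i => x i := by
  classical
  refine ⟨fun y => Φ fun i => if h : i < k then y ⟨i, h⟩ else Classical.arbitrary S, fun x => ?_⟩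
  refine hΦ fun i hi => ?_
  rw [dif_pos (Set.mem_Iio.1 hi)]

lemma dependsOn_mul {k : ℕ} {Φ Ψ : (ℕ → S) → ℝ} (hΦ : DependsOn Φ (Set.Iio k))
    (hΨ : DependsOn Ψ (Set.Iio k)) : DependsOn (fun x => Φ x * Ψ x) (Set.Iio k) :=
  fun _ _ h => congrArg₂ (· * ·) (hΦ h) (hΨ h)

lemma dependsOn_mono_Iio {k l : ℕ} (hkl : k ≤ l) {Φ : (ℕ → S) → ℝ}
    (hΦ : DependsOn Φ (Set.Iio k)) : DependsOn Φ (Set.Iio l) :=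
  fun _ _ h => hΦ fun i hi => h i (lt_of_lt_of_le hi hkl)

lemma dependsOn_eval (k : ℕ) (G : S → ℝ) :
    DependsOn (fun x : ℕ → S => G (x k)) (Set.Iio (k + 1)) :=
  fun _ _ h => congrArg G (h k (Nat.lt_succ_self k))

/-- A process that increases by `c`, or is reset to `W` where `s` holds. -/
noncomputable def resetAge (c : ℝ) (s : S → Bool) (W : S → ℝ) (x : ℕ → S) : ℕ → ℝ
  | 0 => c
  | k + 1 => if s (x k) = true then W (x k) else resetAge c s W x k + c

lemma dependsOn_resetAge (c : ℝ) (s : S → Bool) (W : S → ℝ) (k : ℕ) :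
    DependsOn (fun x => resetAge c s W x k) (Set.Iio k) := by
  induction k with
  | zero => exact fun _ _ _ => rfl
  | succ k ih =>
    intro x y h
    have h1 : x k = y k := h k (Nat.lt_succ_self k)
    have h2 := dependsOn_mono_Iio k.le_succ ih h
    simp only [resetAge, h1, h2]

/-- The indicator of a reset. -/
def resetInd (s : S → Bool) (y : S) : ℝ := if s y = true then 1 else 0

/-- The recursion as an increment: summed over `k` it telescopes and isolates the sum of age times
reset indicator. -/
lemma resetAge_succ (c : ℝ) (s : S → Bool) (W : S → ℝ) (x : ℕ → S) (k : ℕ) :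
    resetAge c s W x (k + 1) = resetAge c s W x k + c +
      resetInd s (x k) * (W (x k) - c) - resetAge c s W x k * resetInd s (x k) := by
  rw [resetAge, resetInd]
  split_ifs <;> ring

end Past

/-! ### Averages along an independent sequence -/

section Averages

variable {Ω : Type*} [MeasurableSpace Ω] {μ : Measure Ω}

/-- The sum of the squares has finite expectation, so it is almost surely finite and its terms tend
to 0. -/
lemma ae_tendsto_zero_of_summable_integral_sq {Y : ℕ → Ω → ℝ}
    (hint : ∀ n, Integrable (fun ω => Y n ω ^ 2) μ)
    (hsum : Summable fun n => ∫ ω, Y n ω ^ 2 ∂μ) :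
    ∀ᵐ ω ∂μ, Tendsto (fun n => Y n ω) atTop (𝓝 0) := by
  have hmeas : ∀ n, AEMeasurable (fun ω => ENNReal.ofReal (Y n ω ^ 2)) μ := fun n =>
    (hint n).aestronglyMeasurable.aemeasurable.ennreal_ofReal
  have h1 : ∫⁻ ω, ∑' n, ENNReal.ofReal (Y n ω ^ 2) ∂μ ≠ ⊤ := by
    rw [lintegral_tsum hmeas]
    have : ∀ n, ∫⁻ ω, ENNReal.ofReal (Y n ω ^ 2) ∂μ = ENNReal.ofReal (∫ ω, Y n ω ^ 2 ∂μ) :=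
      fun n => (ofReal_integral_eq_lintegral_ofReal (hint n)
        (.of_forall fun ω => sq_nonneg _)).symm
    simp_rw [this]
    rw [← ENNReal.ofReal_tsum_of_nonneg (fun n => integral_nonneg fun ω => sq_nonneg _) hsum]
    exact ENNReal.ofReal_ne_top
  filter_upwards [ae_lt_top' (AEMeasurable.tsum hmeas) h1] with ω hω
  have h2 := ENNReal.tendsto_atTop_zero_of_tsum_ne_top hω.ne
  have h3 := (ENNReal.tendsto_toReal ENNReal.zero_ne_top).comp h2
  have h4 : Tendsto (fun n => Y n ω ^ 2) atTop (𝓝 0) := by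
    simpa [Function.comp_def, ENNReal.toReal_ofReal (sq_nonneg _)] using h3
  have h5 := h4.sqrt
  simp only [Real.sqrt_sq_eq_abs, Real.sqrt_zero] at h5
  exact (tendsto_zero_iff_abs_tendsto_zero _).2 h5

variable {S : Type*} [Finite S] [Nonempty S] [MeasurableSpace S] [DiscreteMeasurableSpace S]
  {X : ℕ → Ω → S}

/-- A finite-state sequence in which each term is independent of those before it, all with
expectation functional `E`. -/
structure IsRepeated (μ : Measure Ω) (X : ℕ → Ω → S) (E : (S → ℝ) → ℝ) : Prop where
  measurable : ∀ k, Measurable (X k)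
  indep : ∀ k, IndepFun (fun ω (i : Fin k) => X i ω) (X k) μ
  law : ∀ k G, ∫ ω, G (X k ω) ∂μ = E G

variable {E : (S → ℝ) → ℝ}

lemma IsRepeated.integrable [IsFiniteMeasure μ] (hX : IsRepeated μ X E) {k : ℕ}
    {Φ : (ℕ → S) → ℝ} (hΦ : DependsOn Φ (Set.Iio k)) :
    Integrable (fun ω => Φ fun i => X i ω) μ := by
  obtain ⟨g, hg⟩ := exists_eq_comp_of_dependsOn hΦ
  simp_rw [hg]
  have hm : Measurable fun ω (i : Fin k) => X i ω := measurable_pi_lambda _ fun i => hX.measurable i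
  exact (Integrable.of_finite (f := g)
    (μ := μ.map fun ω (i : Fin k) => X i ω)).comp_measurable hm

lemma IsRepeated.integral_mul (hX : IsRepeated μ X E) {k : ℕ} {Φ : (ℕ → S) → ℝ}
    (hΦ : DependsOn Φ (Set.Iio k)) (G : S → ℝ) :
    ∫ ω, Φ (fun i => X i ω) * G (X k ω) ∂μ = (∫ ω, Φ (fun i => X i ω) ∂μ) * E G := by
  obtain ⟨g, hg⟩ := exists_eq_comp_of_dependsOn hΦ
  simp_rw [hg]
  have hm : Measurable fun ω (i : Fin k) => X i ω := measurable_pi_lambda _ fun i => hX.measurable i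
  have hind := (hX.indep k).comp (φ := g) (ψ := G) .of_discrete .of_discrete
  have := hind.integral_fun_mul_eq_mul_integral
    ((Measurable.of_discrete (f := g)).comp hm).aestronglyMeasurable
    ((Measurable.of_discrete (f := G)).comp (hX.measurable k)).aestronglyMeasurable
  simp only [Function.comp_apply] at this
  rw [this, hX.law]

/-- Law of large numbers for centred variables with random coefficients that depend on the past,
along the squares. -/
lemma IsRepeated.ae_tendsto_sum_sq [IsProbabilityMeasure μ] (hX : IsRepeated μ X E) (ξ : S → ℝ)
    {Φ : ℕ → (ℕ → S) → ℝ} (hΦ : ∀ k, DependsOn (Φ k) (Set.Iio k)) {C : ℝ}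
    (hC : ∀ k, ∫ ω, Φ k (fun i => X i ω) ^ 2 ∂μ ≤ C) :
    ∀ᵐ ω ∂μ, Tendsto (fun n : ℕ => (∑ k ∈ range (n ^ 2),
      Φ k (fun i => X i ω) * (ξ (X k ω) - E ξ)) / ((n ^ 2 : ℕ) : ℝ)) atTop (𝓝 0) := by
  set D : ℕ → (ℕ → S) → ℝ := fun k x => Φ k x * (ξ (x k) - E ξ) with hD
  have hE0 : E (fun s => ξ s - E ξ) = 0 := by
    rw [← hX.law 0, integral_sub, hX.law, integral_const]
    · simp
    · exact hX.integrable (k := 1) (Φ := fun x => ξ (x 0)) (dependsOn_eval 0 ξ)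
    · exact integrable_const _
  have hDdep : ∀ k, DependsOn (D k) (Set.Iio (k + 1)) := fun k =>
    dependsOn_mul (dependsOn_mono_Iio k.le_succ (hΦ k)) (dependsOn_eval k fun s => ξ s - E ξ)
  -- The centred factor at time `j` is independent of everything else in the product.
  have horth : ∀ i j, i < j → ∫ ω, D i (fun i => X i ω) * D j (fun i => X i ω) ∂μ = 0 := by
    intro i j hij
    have := hX.integral_mul (k := j) (Φ := fun x => D i x * Φ j x)
      (dependsOn_mul (dependsOn_mono_Iio hij (hDdep i)) (hΦ j)) (fun s => ξ s - E ξ)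
    rw [hE0, mul_zero] at this
    rw [← this]
    exact integral_congr_ae (.of_forall fun ω => by simp only [hD]; ring)
  set B := E fun s => (ξ s - E ξ) ^ 2 with hB
  have hB0 : 0 ≤ B := by
    rw [hB, ← hX.law 0]
    exact integral_nonneg fun ω => sq_nonneg _
  have hsq : ∀ k, ∫ ω, D k (fun i => X i ω) * D k (fun i => X i ω) ∂μ ≤ C * B := by
    intro k
    have := hX.integral_mul (k := k) (Φ := fun x => Φ k x * Φ k x)
      (dependsOn_mul (hΦ k) (hΦ k)) (fun s => (ξ s - E ξ) ^ 2)
    calc _ = ∫ ω, Φ k (fun i => X i ω) * Φ k (fun i => X i ω) * (ξ (X k ω) - E ξ) ^ 2 ∂μ :=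
          integral_congr_ae (.of_forall fun ω => by simp only [hD]; ring)
      _ = _ := this
      _ ≤ C * B := by
          refine mul_le_mul_of_nonneg_right ?_ hB0
          simpa [sq] using hC k
  have hint : ∀ i j, Integrable (fun ω => D i (fun i => X i ω) * D j (fun i => X i ω)) μ := by
    intro i j
    exact hX.integrable (k := max (i + 1) (j + 1)) (Φ := fun x => D i x * D j x)
      (dependsOn_mul (dependsOn_mono_Iio (le_max_left _ _) (hDdep i))
        (dependsOn_mono_Iio (le_max_right _ _) (hDdep j)))
  have hsumsq : ∀ n ω, (∑ k ∈ range n, D k (fun i => X i ω)) ^ 2 =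
      ∑ i ∈ range n, ∑ j ∈ range n, D i (fun i => X i ω) * D j (fun i => X i ω) := by
    intro n ω
    rw [sq, sum_mul_sum]
  have hvarint : ∀ n, Integrable (fun ω => (∑ k ∈ range n, D k (fun i => X i ω)) ^ 2) μ := by
    intro n
    simp_rw [hsumsq]
    exact integrable_finsetSum _ fun i _ => integrable_finsetSum _ fun j _ => hint i j
  have hvar : ∀ n, ∫ ω, (∑ k ∈ range n, D k (fun i => X i ω)) ^ 2 ∂μ ≤ n * (C * B) := by
    intro n
    simp_rw [hsumsq]
    rw [integral_finsetSum _ fun i _ => integrable_finsetSum _ fun j _ => hint i j]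
    calc _ ≤ ∑ i ∈ range n, C * B := by
          refine sum_le_sum fun i hi => ?_
          rw [integral_finsetSum _ fun j _ => hint i j, sum_eq_single i]
          · exact hsq i
          · intro j _ hji
            rcases lt_or_gt_of_ne hji with h | h
            · simp_rw [mul_comm (D i _)]
              exact horth j i h
            · exact horth i j h
          · intro h
            exact absurd hi h
      _ = n * (C * B) := by simp
  have hCB : 0 ≤ C * B :=
    mul_nonneg ((integral_nonneg fun ω => sq_nonneg _).trans (hC 0)) hB0
  refine ae_tendsto_zero_of_summable_integral_sq (fun n => ?_) ?_
  · simp_rw [div_pow]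
    exact (hvarint _).div_const _
  -- By orthogonality the second moment of a sum of N terms is at most N·C·B; after division by N²
  -- with N = n² this is C·B/n², which is summable.
  · refine Summable.of_nonneg_of_le (fun n => integral_nonneg fun ω => sq_nonneg _) (fun n => ?_)
      ((Real.summable_nat_pow_inv.2 (by norm_num : 1 < 2)).mul_left (C * B))
    simp_rw [div_pow]
    rw [integral_div]
    rcases Nat.eq_zero_or_pos n with rfl | hn
    · simp
    have hn' : (0 : ℝ) < n := by exact_mod_cast hn
    rw [div_le_iff₀ (by positivity)]
    refine (hvar _).trans_eq ?_
    push_cast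
    field_simp

/-- A reset with probability q beats the linear growth: Young's inequality bounds (x + c)² by (1 +
q/2)x² + (1 + 2/q)c², and (1 + q/2)(1 - q) ≤ 1 - q/2 leaves a contraction. -/
lemma IsRepeated.exists_integral_resetAge_sq_le [IsProbabilityMeasure μ] (hX : IsRepeated μ X E)
    (c : ℝ) (s : S → Bool) (W : S → ℝ) (hq : 0 < E (resetInd s)) :
    ∃ C, ∀ k, ∫ ω, resetAge c s W (fun i => X i ω) k ^ 2 ∂μ ≤ C := by
  set q := E (resetInd s) with hqdef
  set Q := E (fun y => resetInd s y * W y ^ 2) with hQ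
  have hQ0 : 0 ≤ Q := by
    rw [hQ, ← hX.law 0]
    refine integral_nonneg fun ω => mul_nonneg ?_ (sq_nonneg _)
    rw [resetInd]; split_ifs <;> norm_num
  have hE1 : E (fun y => 1 - resetInd s y) = 1 - q := by
    rw [hqdef, ← hX.law 0, ← hX.law 0, integral_sub, integral_const]
    · simp
    · exact integrable_const _
    · exact hX.integrable (k := 1) (Φ := fun x => resetInd s (x 0)) (dependsOn_eval 0 _)
  have hq1 : q ≤ 1 := by
    have : 0 ≤ E (fun y => 1 - resetInd s y) := by
      rw [← hX.law 0]
      refine integral_nonneg fun ω => ?_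
      simp only [Pi.zero_apply, resetInd]
      split_ifs <;> norm_num
    linarith
  set R := (1 + 2 / q) * c ^ 2 with hR
  have hR0 : 0 ≤ R := by positivity
  -- 2(Q + R)/q is the fixed point of a ↦ (1 - q/2)a + Q + R; the summand c² covers the initial
  -- value.
  refine ⟨c ^ 2 + 2 * (Q + R) / q, fun k => ?_⟩
  induction k with
  | zero =>
    simp only [resetAge, integral_const, probReal_univ, smul_eq_mul, one_mul]
    have : 0 ≤ 2 * (Q + R) / q := by positivity
    linarith
  | succ k ih =>
    have hdep := dependsOn_resetAge c s W k
    set a := ∫ ω, resetAge c s W (fun i => X i ω) k ^ 2 ∂μ with ha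
    have ha0 : 0 ≤ a := integral_nonneg fun ω => sq_nonneg _
    have hint2 : Integrable (fun ω => resetAge c s W (fun i => X i ω) k ^ 2) μ :=
      hX.integrable (k := k) (Φ := fun x => resetAge c s W x k ^ 2)
        fun x y h => congrArg (· ^ 2) (hdep h)
    have hdep' : DependsOn (fun x => (resetAge c s W x k + c) ^ 2) (Set.Iio k) :=
      fun x y h => congrArg (fun r => (r + c) ^ 2) (hdep h)
    have hstep : ∫ ω, resetAge c s W (fun i => X i ω) (k + 1) ^ 2 ∂μ =
        Q + (∫ ω, (resetAge c s W (fun i => X i ω) k + c) ^ 2 ∂μ) * (1 - q) := by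
      rw [← hE1, ← hX.integral_mul hdep', hQ, ← hX.law k, ← integral_add]
      · refine integral_congr_ae (.of_forall fun ω => ?_)
        simp only [resetAge, resetInd]
        split_ifs <;> ring
      · exact hX.integrable (k := k + 1) (Φ := fun x => resetInd s (x k) * W (x k) ^ 2)
          (dependsOn_eval k fun y => resetInd s y * W y ^ 2)
      · exact hX.integrable (k := k + 1)
          (Φ := fun x => (resetAge c s W x k + c) ^ 2 * (1 - resetInd s (x k)))
          (dependsOn_mul (dependsOn_mono_Iio k.le_succ hdep')
            (dependsOn_eval k fun y => 1 - resetInd s y))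
    have hbound : ∫ ω, (resetAge c s W (fun i => X i ω) k + c) ^ 2 ∂μ ≤ (1 + q / 2) * a + R := by
      have : (1 + q / 2) * a + R =
          ∫ ω, ((1 + q / 2) * resetAge c s W (fun i => X i ω) k ^ 2 + R) ∂μ := by
        rw [integral_add (hint2.const_mul _) (integrable_const _), integral_const_mul,
          integral_const]
        simp [ha]
      rw [this]
      refine integral_mono (hX.integrable hdep') ((hint2.const_mul _).add (integrable_const _))
        fun ω => ?_
      simp only
      set x := resetAge c s W (fun i => X i ω) k
      -- This square is exactly the gap in Young's inequality.
      have h1 : 0 ≤ (q * x - 2 * c) ^ 2 / (2 * q) := by positivity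
      have h2 : (q * x - 2 * c) ^ 2 / (2 * q) = q / 2 * x ^ 2 - 2 * x * c + 2 / q * c ^ 2 := by
        field_simp
        ring
      rw [hR]
      nlinarith
    rw [hstep]
    have h1 : (∫ ω, (resetAge c s W (fun i => X i ω) k + c) ^ 2 ∂μ) * (1 - q) ≤
        ((1 + q / 2) * a + R) * (1 - q) := mul_le_mul_of_nonneg_right hbound (by linarith)
    have h2 : ((1 + q / 2) * a + R) * (1 - q) ≤ (1 - q / 2) * a + R := by
      nlinarith [mul_nonneg hq.le ha0, mul_nonneg hq.le hR0, mul_nonneg (sq_nonneg q) ha0]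
    have h3 : (1 - q / 2) * a ≤ (1 - q / 2) * (c ^ 2 + 2 * (Q + R) / q) :=
      mul_le_mul_of_nonneg_left ih (by linarith)
    have h4 : (1 - q / 2) * (c ^ 2 + 2 * (Q + R) / q) =
        c ^ 2 + 2 * (Q + R) / q - q / 2 * c ^ 2 - (Q + R) := by
      field_simp
      ring
    have h5 : 0 ≤ q / 2 * c ^ 2 := by positivity
    linarith

lemma tendsto_sq_atTop : Tendsto (fun n : ℕ => n ^ 2) atTop atTop :=
  tendsto_pow_atTop two_ne_zero

/-- The law of large numbers along the squares. -/
lemma IsRepeated.ae_tendsto_average_sq [IsProbabilityMeasure μ] (hX : IsRepeated μ X E)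
    (ξ : S → ℝ) :
    ∀ᵐ ω ∂μ, Tendsto (fun n : ℕ => (∑ k ∈ range (n ^ 2), ξ (X k ω)) / ((n ^ 2 : ℕ) : ℝ))
      atTop (𝓝 (E ξ)) := by
  filter_upwards [hX.ae_tendsto_sum_sq ξ (Φ := fun _ _ => 1) (fun k _ _ _ => rfl) (C := 1)
    (fun k => by simp)] with ω hω
  have := hω.add_const (E ξ)
  rw [zero_add] at this
  refine this.congr' ?_
  filter_upwards [eventually_gt_atTop 0] with n hn
  have hn' : (0 : ℝ) < n := by exact_mod_cast hn
  simp only [one_mul, sum_sub_distrib, sum_const, card_range, nsmul_eq_mul]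
  push_cast
  field_simp
  ring

/-- Time averages of the age process, along the squares. -/
lemma IsRepeated.ae_tendsto_resetAge [IsProbabilityMeasure μ] (hX : IsRepeated μ X E)
    (c : ℝ) (s : S → Bool) (W : S → ℝ) (hq : 0 < E (resetInd s)) (ξ : S → ℝ) :
    ∀ᵐ ω ∂μ,
      Tendsto (fun n : ℕ => resetAge c s W (fun i => X i ω) (n ^ 2) / ((n ^ 2 : ℕ) : ℝ))
        atTop (𝓝 0) ∧
      Tendsto (fun n : ℕ => (∑ k ∈ range (n ^ 2), resetAge c s W (fun i => X i ω) k) /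
        ((n ^ 2 : ℕ) : ℝ)) atTop
        (𝓝 ((c + E (fun y => resetInd s y * (W y - c))) / E (resetInd s))) ∧
      Tendsto (fun n : ℕ => (∑ k ∈ range (n ^ 2),
        resetAge c s W (fun i => X i ω) k * ξ (X k ω)) / ((n ^ 2 : ℕ) : ℝ)) atTop
        (𝓝 ((c + E (fun y => resetInd s y * (W y - c))) / E (resetInd s) * E ξ)) := by
  obtain ⟨C, hC⟩ := hX.exists_integral_resetAge_sq_le c s W hq
  have hdep := dependsOn_resetAge c s W
  have hA : ∀ᵐ ω ∂μ,
      Tendsto (fun n : ℕ => resetAge c s W (fun i => X i ω) (n ^ 2) / ((n ^ 2 : ℕ) : ℝ))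
        atTop (𝓝 0) := by
    have hint : ∀ k, Integrable (fun ω => resetAge c s W (fun i => X i ω) k ^ 2) μ := fun k =>
      hX.integrable (k := k) (Φ := fun x => resetAge c s W x k ^ 2)
        fun x y h => congrArg (· ^ 2) (hdep k h)
    have hC0 : 0 ≤ C := (integral_nonneg fun ω => sq_nonneg _).trans (hC 0)
    refine ae_tendsto_zero_of_summable_integral_sq (fun n => ?_) ?_
    · simp_rw [div_pow]
      exact (hint _).div_const _
    · refine Summable.of_nonneg_of_le (fun n => integral_nonneg fun ω => sq_nonneg _)
        (fun n => ?_) ((Real.summable_nat_pow_inv.2 (by norm_num : 1 < 2)).mul_left C)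
      simp_rw [div_pow]
      rw [integral_div]
      rcases Nat.eq_zero_or_pos n with rfl | hn
      · simp
      have hn' : (1 : ℝ) ≤ n := by exact_mod_cast hn
      rw [div_le_iff₀ (by positivity)]
      refine (hC _).trans ?_
      push_cast
      have : C * ((n : ℝ) ^ 2)⁻¹ * ((n : ℝ) ^ 2) ^ 2 = C * (n : ℝ) ^ 2 := by
        field_simp
      rw [this]
      exact le_mul_of_one_le_right hC0 (one_le_pow₀ hn')
  filter_upwards [hA, hX.ae_tendsto_sum_sq (resetInd s) hdep hC, hX.ae_tendsto_sum_sq ξ hdep hC,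
    hX.ae_tendsto_average_sq (fun y => resetInd s y * (W y - c))] with ω h1 h2 h3 h4
  set A := resetAge c s W (fun i => X i ω) with hAdef
  -- The telescoped recursion; `c` in the last bracket is the initial age.
  have htel : ∀ n, ∑ k ∈ range n, A k * resetInd s (X k ω) =
      n * c + ∑ k ∈ range n, resetInd s (X k ω) * (W (X k ω) - c) - (A n - c) := by
    intro n
    induction n with
    | zero => simp [hAdef, resetAge]
    | succ n ih =>
      rw [sum_range_succ, sum_range_succ, ih]
      have := resetAge_succ c s W (fun i => X i ω) n
      rw [← hAdef] at this
      rw [this]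
      push_cast
      ring
  have hc : Tendsto (fun n : ℕ => c / ((n ^ 2 : ℕ) : ℝ)) atTop (𝓝 0) :=
    (tendsto_const_div_atTop_nhds_zero_nat c).comp tendsto_sq_atTop
  -- The average of age times reset indicator is known from `htel`, and differs by o(1) from the
  -- mean of the indicator times the average age; divide.
  have h5 : Tendsto (fun n : ℕ => (∑ k ∈ range (n ^ 2), A k) / ((n ^ 2 : ℕ) : ℝ)) atTop
      (𝓝 ((c + E (fun y => resetInd s y * (W y - c))) / E (resetInd s))) := by
    have := ((((h4.const_add c).sub h1).add hc).sub h2).div_const (E (resetInd s))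
    simp only [sub_zero, add_zero] at this
    refine this.congr' ?_
    filter_upwards [eventually_gt_atTop 0] with n hn
    have hn' : (0 : ℝ) < ((n ^ 2 : ℕ) : ℝ) := by exact_mod_cast pow_pos hn 2
    simp only [mul_sub, sum_sub_distrib, htel (n ^ 2), ← sum_mul]
    field_simp
    ring
  refine ⟨h1, h5, ?_⟩
  have := h3.add (h5.mul_const (E ξ))
  rw [zero_add] at this
  refine this.congr fun n => ?_
  simp only [mul_sub, sum_sub_distrib, ← sum_mul]
  ring

end Averages

/-! ### The age of the update at the end of the frame in which it is generated -/

/-- The sum is the probability that the last `j` slots are silent; it factors over the slots. -/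
lemma sum_prod_bern_mul_trailing (ρ : ℝ) {j : ℕ} (hj : j ≤ M) :
    ∑ a : Fin M → Bool, (∏ t, bern ρ (a t)) *
      (if ∀ t : Fin M, M - j ≤ t → a t = false then 1 else 0) = (1 - ρ) ^ j := by
  have h1 : ∀ a : Fin M → Bool, (∏ t, bern ρ (a t)) *
      (if ∀ t : Fin M, M - j ≤ t → a t = false then 1 else 0) =
      ∏ t : Fin M, (bern ρ (a t) * if M - j ≤ t → a t = false then 1 else 0) := by
    intro a
    rw [prod_mul_distrib, prod_boole]
    simp
  have h2 := prod_univ_sum (fun _ : Fin M => (univ : Finset Bool))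
    (fun t b => bern ρ b * if M - j ≤ t → b = false then 1 else 0)
  rw [Fintype.piFinset_univ] at h2
  rw [sum_congr rfl fun a _ => h1 a, ← h2]
  have h3 : ∀ t : Fin M, (∑ b, bern ρ b * (if M - j ≤ t → b = false then 1 else 0)) =
      (fun t : ℕ => if M - j ≤ t then 1 - ρ else 1) t := by
    intro t
    by_cases ht : M - j ≤ t <;> simp [ht, bern]
  rw [prod_congr rfl fun t _ => h3 t, Fin.prod_univ_eq_prod_range
    (fun t : ℕ => if M - j ≤ t then 1 - ρ else 1), prod_ite, prod_const, prod_const_one, mul_one]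
  have : (range M).filter (fun t => M - j ≤ t) = Ico (M - j) M := by
    ext t; simp; omega
  rw [this, Nat.card_Ico]
  congr 1
  omega

/-- For a nonempty pattern, M minus the last position is the number of j < M for which the last j
slots are silent. Its mean is thus a geometric sum, less the share M(1 - ρ)^M of the empty pattern.
-/
lemma arrivalMean_sub_lastArrival (hM : 0 < M) {ρ : ℝ} (hρ : 0 < ρ) :
    arrivalMean ρ (fun a : Fin M → Bool => (M : ℝ) - lastArrival a) =
      pUpdate M ρ / ρ - M * (1 - ρ) ^ M := by
  have hcount : ∀ a : Fin M → Bool, (∃ t, a t = true) →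
      (∑ j ∈ range M, if ∀ t : Fin M, M - j ≤ t → a t = false then (1 : ℝ) else 0) =
        (M : ℝ) - lastArrival a := by
    rintro a ⟨t, ht⟩
    rw [sum_boole]
    have hlt := lastArrival_lt hM a
    obtain ⟨s, hs, hs'⟩ := exists_mem_eq_sup (univ.filter fun t => a t = true)
      ⟨t, by simpa using ht⟩ Fin.val
    have : (range M).filter (fun j => ∀ t : Fin M, M - j ≤ t → a t = false) =
        range (M - lastArrival a) := by
      ext j
      simp only [mem_filter, mem_range]
      constructor
      · rintro ⟨hj, h⟩
        by_contra hcon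
        have h1 := h s (by rw [← hs']; change M - j ≤ lastArrival a; omega)
        rw [(mem_filter.1 hs).2] at h1
        cases h1
      · intro hj
        refine ⟨by omega, fun r hr => ?_⟩
        by_contra hcon
        have : (r : ℕ) ≤ lastArrival a :=
          Finset.le_sup (f := Fin.val) (mem_filter.2 ⟨mem_univ r, by simpa using hcon⟩)
        omega
    rw [this, card_range, Nat.cast_sub hlt.le]
  have htot : ∑ a : Fin M → Bool, (∏ t, bern ρ (a t)) *
      (∑ j ∈ range M, if ∀ t : Fin M, M - j ≤ t → a t = false then (1 : ℝ) else 0) =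
      pUpdate M ρ / ρ := by
    simp_rw [mul_sum]
    rw [sum_comm, sum_congr rfl fun j hj => sum_prod_bern_mul_trailing ρ (mem_range.1 hj).le,
      geom_sum_eq (by linarith), pUpdate, div_eq_div_iff (by linarith) hρ.ne']
    ring
  have hsplit := sum_filter_add_sum_filter_not univ (fun a : Fin M → Bool => ∃ t, a t = true)
    (fun a => (∏ t, bern ρ (a t)) *
      (∑ j ∈ range M, if ∀ t : Fin M, M - j ≤ t → a t = false then (1 : ℝ) else 0))
  have h2 : (univ.filter fun a : Fin M → Bool => ¬ ∃ t, a t = true) = {fun _ => false} := by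
    ext a
    simp [funext_iff]
  rw [htot, h2, sum_singleton] at hsplit
  simp only [bern, Bool.false_eq_true, if_false, prod_const, card_univ, Fintype.card_fin,
    implies_true, if_true, sum_const, card_range, nsmul_eq_mul, mul_one] at hsplit
  rw [arrivalMean, sum_congr rfl fun a ha => by rw [← hcount a (mem_filter.1 ha).2]]
  simp only [bern]
  linarith

/-! ### The age within a frame -/

lemma Served.unique {z : Fin N → UserFrame M V} {n : Fin N} {i j : ℕ} (hi : Served z n i)
    (hj : Served z n j) : i = j :=
  hi.2.symm.trans hj.2

/-- The user is successful, after fewer than `m` other successful users. -/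
def ServedBefore (z : Fin N → UserFrame M V) (n : Fin N) (m : ℕ) : Prop := ∃ j < m, Served z n j

instance (z : Fin N → UserFrame M V) (n : Fin N) (m : ℕ) : Decidable (ServedBefore z n m) := by
  unfold ServedBefore; infer_instance

/-- The user is served in one of the data slots. -/
def isServed (n : Fin N) (z : Fin N → UserFrame M V) : Bool :=
  decide (ServedBefore z n (M - 1))

/-- The age at the end of the frame if the user is served. -/
noncomputable def resetValue (n : Fin N) (z : Fin N → UserFrame M V) : ℝ :=
  2 * M - lastArrival (z n).1

/-- The time from the reception to the end of the frame. -/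
noncomputable def restTime (n : Fin N) (z : Fin N → UserFrame M V) : ℝ :=
  ∑ j ∈ range (M - 1), if Served z n j then (M : ℝ) - (j + 2) else 0

lemma latestGen_of_lt (P : Path N V) (n : Fin N) (u₀ : ℤ) {t : ℕ} (ht : t ≤ M) :
    latestGen M P n u₀ t = u₀ := by
  induction t with
  | zero => rfl
  | succ t ih => rw [latestGen, if_neg (not_received_of_lt P n ht), ih (by omega)]

/-- At most one update of the user arrives per frame. One of rank j uses slot j + 1 and is visible
from offset j + 2 on, hence the bound j < i - 1; truncated subtraction rightly gives none at i = 0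
and i = 1. -/
lemma latestGen_frame (hM : 2 ≤ M) (P : Path N V) (n : Fin N) (u₀ : ℤ) (k : ℕ) {i : ℕ}
    (hi : i ≤ M) :
    latestGen M P n u₀ ((k + 1) * M + i) =
      if ServedBefore (frameOf M P k) n (i - 1) then
        ((k * M + lastArrival (frameOf M P k n).1 : ℕ) : ℤ)
      else latestGen M P n u₀ ((k + 1) * M) := by
  have hM0 : 0 < M := by omega
  induction i with
  | zero => simp [ServedBefore]
  | succ i ih =>
    rw [← add_assoc, latestGen]
    have hdiv : ((k + 1) * M + i) / M = k + 1 := by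
      rw [mul_comm, Nat.mul_add_div hM0, Nat.div_eq_of_lt hi, add_zero]
    cases i with
    | zero =>
      rw [add_zero, if_neg (not_received_frame_start P n (k + 1))]
      simp [ServedBefore]
    | succ j =>
      rw [received_iff_served hM0 P n k hi, hdiv]
      by_cases h : Served (frameOf M P k) n j
      · rw [if_pos h, genTime_succ hM0 P n k h.exists_arrival, if_pos]
        exact ⟨j, by simp, h⟩
      · rw [if_neg h, ih (by omega)]
        have : ServedBefore (frameOf M P k) n (j + 1 - 1) ↔
            ServedBefore (frameOf M P k) n (j + 1 + 1 - 1) := by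
          simp only [Nat.add_sub_cancel, ServedBefore]
          constructor
          · rintro ⟨l, hl, hl'⟩
            exact ⟨l, by omega, hl'⟩
          · rintro ⟨l, hl, hl'⟩
            refine ⟨l, lt_of_le_of_ne (by omega) ?_, hl'⟩
            rintro rfl
            exact h hl'
        simp only [this]

/-- With initial value 0 the age at the start of frame 1 is M, which is both the start and the
increment of `resetAge`. -/
lemma aoi_frame_start (hM : 2 ≤ M) (P : Path N V) (n : Fin N) (k : ℕ) :
    (aoi M P n 0 ((k + 1) * M) : ℝ) = resetAge M (isServed n) (resetValue n) (frameOf M P) k := by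
  induction k with
  | zero =>
    rw [zero_add, one_mul, aoi, latestGen_of_lt P n 0 le_rfl]
    simp [resetAge]
  | succ k ih =>
    have h := latestGen_frame hM P n 0 k (le_refl M)
    rw [aoi, show (k + 1 + 1) * M = (k + 1) * M + M by ring, h, resetAge]
    by_cases hs : ServedBefore (frameOf M P k) n (M - 1)
    · rw [if_pos hs, if_pos (by simpa [isServed] using hs), resetValue]
      push_cast
      ring
    · rw [if_neg hs, if_neg (by simpa [isServed] using hs), ← ih, aoi]
      push_cast
      ring

lemma restTime_eq_card (n : Fin N) (z : Fin N → UserFrame M V) :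
    restTime n z =
      ∑ i ∈ range M, if ServedBefore z n (i - 1) then (1 : ℝ) else 0 := by
  rw [restTime]
  by_cases h : ServedBefore z n (M - 1)
  · obtain ⟨j, hj, hs⟩ := h
    rw [sum_eq_single_of_mem j (mem_range.2 hj)
      (fun l _ hl => if_neg fun hl' => hl (hl'.unique hs)), if_pos hs, sum_boole]
    have : (range M).filter (fun i => ServedBefore z n (i - 1)) = Ico (j + 2) M := by
      ext i
      rw [mem_filter, mem_range, mem_Ico]
      constructor
      · rintro ⟨hi, l, hl, hl'⟩
        obtain rfl := hl'.unique hs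
        omega
      · rintro ⟨h1, h2⟩
        exact ⟨h2, j, by omega, hs⟩
    rw [this, Nat.card_Ico, Nat.cast_sub (by omega)]
    push_cast
    rfl
  · simp only [ServedBefore, not_exists, not_and] at h
    rw [sum_eq_zero fun j hj => if_neg (h j (mem_range.1 hj)), sum_eq_zero]
    intro i hi
    rw [if_neg]
    rintro ⟨j, hj, hs⟩
    have := mem_range.1 hi
    exact h j (by omega) hs

/-- Without reception the ages would be A, A + 1, …; for the last `restTime` slots A is replaced by
`resetValue - M`, the age of the new update at the frame's start. -/
lemma sum_aoi_frame (hM : 2 ≤ M) (P : Path N V) (n : Fin N) (k : ℕ) :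
    ∑ i ∈ range M, (aoi M P n 0 ((k + 1) * M + i) : ℝ) =
      M * resetAge M (isServed n) (resetValue n) (frameOf M P) k + M * (M - 1) / 2 -
        (resetAge M (isServed n) (resetValue n) (frameOf M P) k * restTime n (frameOf M P k) -
          restTime n (frameOf M P k) * (resetValue n (frameOf M P k) - M)) := by
  rw [← aoi_frame_start hM P n k]
  have hterm : ∀ i ∈ range M, (aoi M P n 0 ((k + 1) * M + i) : ℝ) =
      (aoi M P n 0 ((k + 1) * M) : ℝ) + i -
        (if ServedBefore (frameOf M P k) n (i - 1) then (1 : ℝ) else 0) *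
        ((aoi M P n 0 ((k + 1) * M) : ℝ) - (resetValue n (frameOf M P k) - M)) := by
    intro i hi
    rw [aoi, latestGen_frame hM P n 0 k (mem_range.1 hi).le, aoi, resetValue]
    split_ifs
    · push_cast
      ring
    · push_cast
      ring
  have hgauss : ∑ i ∈ range M, (i : ℝ) = M * (M - 1) / 2 := by
    have h := sum_range_id_mul_two M
    have h1 : ((∑ i ∈ range M, i : ℕ) : ℝ) * 2 = M * ((M - 1 : ℕ) : ℝ) := by exact_mod_cast h
    rw [Nat.cast_sub (by omega)] at h1
    push_cast at h1
    linarith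
  rw [sum_congr rfl hterm, sum_sub_distrib, sum_add_distrib, ← sum_mul, ← restTime_eq_card,
    hgauss, sum_const, card_range, nsmul_eq_mul]
  ring

lemma sum_aoi_frames (hM : 2 ≤ M) (P : Path N V) (n : Fin N) (K : ℕ) :
    ∑ t ∈ range (M * (K + 1)), (aoi M P n 0 t : ℝ) =
      M * (M - 1) / 2 + ∑ k ∈ range K, ∑ i ∈ range M, (aoi M P n 0 ((k + 1) * M + i) : ℝ) := by
  induction K with
  | zero =>
    have h := sum_range_id_mul_two M
    have h1 : ((∑ i ∈ range M, i : ℕ) : ℝ) * 2 = M * ((M - 1 : ℕ) : ℝ) := by exact_mod_cast h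
    rw [Nat.cast_sub (by omega)] at h1
    push_cast at h1
    rw [zero_add, mul_one, sum_range_zero, add_zero]
    have : ∀ t ∈ range M, (aoi M P n 0 t : ℝ) = t := by
      intro t ht
      rw [aoi, latestGen_of_lt P n 0 (mem_range.1 ht).le]
      simp
    rw [sum_congr rfl this]
    linarith
  | succ K ih =>
    rw [show M * (K + 1 + 1) = M * (K + 1) + M by ring, sum_range_add, ih, sum_range_succ,
      add_assoc, mul_comm M (K + 1)]

/-! ### Nonnegative ages and loss of memory of the initial value. -/

lemma genTime_le (P : Path N V) (n : Fin N) (k : ℕ) : genTime M P n k ≤ k * M :=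
  Finset.sup_le fun _ hx => (mem_range.1 (mem_filter.1 hx).1).le

lemma latestGen_le (P : Path N V) (n : Fin N) (t : ℕ) : latestGen M P n 0 t ≤ t := by
  induction t with
  | zero => simp [latestGen]
  | succ t ih =>
    rw [latestGen]
    split_ifs
    · have h1 := genTime_le (M := M) P n (t / M)
      have h2 := Nat.div_mul_le_self t M
      push_cast
      omega
    · push_cast
      omega

lemma aoi_nonneg (P : Path N V) (n : Fin N) (t : ℕ) : 0 ≤ aoi M P n 0 t := by
  have := latestGen_le (M := M) P n t
  rw [aoi]
  omega

lemma latestGen_eq_of_received {P : Path N V} {n : Fin N} {t₀ : ℕ} (h : Received M P n t₀)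
    (u v : ℤ) {t : ℕ} (ht : t₀ < t) : latestGen M P n u t = latestGen M P n v t := by
  induction t, ht using Nat.le_induction with
  | base => simp [latestGen, h]
  | succ t _ ih => simp [latestGen, ih]

/-! ### The average age -/

/-- The expectation of a function of the choices that determine a frame. -/
noncomputable def frameMean (ρ γ : ℝ) (G : (Fin N → UserFrame M V) → ℝ) : ℝ :=
  ∑ z, (∏ m, userWeight ρ γ (z m)) * G z

/-- The serving slot enters through `w` and the arrivals through `F`, and the two factor; every mean
needed below is an instance. -/
lemma frameMean_sum_served (hV : 1 ≤ V) (ρ γ : ℝ) (n : Fin N) (w : ℕ → ℝ)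
    (F : (Fin M → Bool) → ℝ) :
    frameMean (V := V) ρ γ (fun z => ∑ j ∈ range (M - 1),
      (if Served z n j then w j else 0) * F (z n).1) =
      γ * arrivalMean ρ F * ∑ j ∈ range (M - 1), w j * phi N M V ρ γ (j + 2) := by
  simp only [frameMean, mul_sum]
  rw [sum_comm]
  refine sum_congr rfl fun j _ => ?_
  have h := sum_weight_served hV ρ γ F n j
  calc _ = w j * ∑ z : Fin N → UserFrame M V, (∏ m, userWeight ρ γ (z m)) *
        (if Served z n j then F (z n).1 else 0) := by
        rw [mul_sum]
        refine sum_congr rfl fun z _ => ?_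
        split_ifs <;> ring
    _ = _ := by rw [h]; ring

lemma resetInd_isServed (n : Fin N) (z : Fin N → UserFrame M V) :
    resetInd (isServed n) z = ∑ j ∈ range (M - 1), if Served z n j then (1 : ℝ) else 0 := by
  by_cases h : ServedBefore z n (M - 1)
  · rw [resetInd, if_pos (by simpa [isServed] using h)]
    obtain ⟨j, hj, hs⟩ := h
    rw [sum_eq_single_of_mem j (mem_range.2 hj)
      (fun l _ hl => if_neg fun hl' => hl (hl'.unique hs)), if_pos hs]
  · rw [resetInd, if_neg (by simpa [isServed] using h), sum_eq_zero]
    intro j hj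
    exact if_neg fun hs => h ⟨j, mem_range.1 hj, hs⟩

lemma sum_range_add_two {β : Type*} [AddCommMonoid β] (M : ℕ) (f : ℕ → β) :
    ∑ j ∈ range (M - 1), f (j + 2) = ∑ α ∈ Icc 2 M, f α := by
  refine sum_bij' (fun j _ => j + 2) (fun α _ => α - 2) ?_ ?_ ?_ ?_ ?_ <;>
    intro x hx <;> simp only [mem_range, mem_Icc] at hx ⊢ <;> omega

lemma frameMean_resetInd_mul (hV : 1 ≤ V) (ρ γ : ℝ) (n : Fin N) (F : (Fin M → Bool) → ℝ) :
    frameMean (V := V) ρ γ (fun z => resetInd (isServed n) z * F (z n).1) =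
      γ * arrivalMean ρ F * pS N M V ρ γ := by
  have h := frameMean_sum_served hV ρ γ n (fun _ => 1) F
  simp only [one_mul, sum_range_add_two M (phi N M V ρ γ), ← pS_eq_sum_phi] at h
  rw [← h]
  simp only [resetInd_isServed, sum_mul]

lemma frameMean_restTime_mul (hV : 1 ≤ V) (ρ γ : ℝ) (n : Fin N) (F : (Fin M → Bool) → ℝ) :
    frameMean (V := V) ρ γ (fun z => restTime n z * F (z n).1) =
      γ * arrivalMean ρ F * (M * pS N M V ρ γ - ∑ α ∈ Icc 2 M, phi N M V ρ γ α * α) := by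
  have h := frameMean_sum_served hV ρ γ n (fun j => (M : ℝ) - (j + 2)) F
  have h2 := sum_range_add_two M (fun α => ((M : ℝ) - α) * phi N M V ρ γ α)
  push_cast at h2
  rw [h2] at h
  have h3 : ∑ α ∈ Icc 2 M, ((M : ℝ) - α) * phi N M V ρ γ α =
      M * pS N M V ρ γ - ∑ α ∈ Icc 2 M, phi N M V ρ γ α * α := by
    rw [pS_eq_sum_phi, mul_sum, ← sum_sub_distrib]
    exact sum_congr rfl fun α _ => by ring
  rw [← h3, ← h]
  simp only [restTime, sum_mul]

section Law

variable {Ω : Type*} [MeasurableSpace Ω] {μ : Measure Ω} [IsProbabilityMeasure μ] {ρ γ : ℝ}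
  {P : Ω → Path N V}

lemma IsNetwork.isRepeated (hP : IsNetwork μ ρ γ P) :
    IsRepeated μ (fun k ω => frameOf M (P ω) k) (frameMean ρ γ) where
  measurable k := hP.measurable_frameOf k
  indep k := hP.indepFun_frameOf k
  law k G := hP.integral_frameOf k G

/-- The average age, along the ends of the frames with square numbers. -/
lemma IsNetwork.ae_tendsto_sum_aoi (hP : IsNetwork μ ρ γ P) (hM : 2 ≤ M) (hV : 1 ≤ V)
    (hρ : 0 < ρ) (hρ1 : ρ ≤ 1) (hγ : 0 < γ) (hpS : 0 < pS N M V ρ γ) (n : Fin N) :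
    ∀ᵐ ω ∂μ, (∃ t, Received M (P ω) n t) ∧ Tendsto (fun K : ℕ =>
      (∑ t ∈ range (M * (K ^ 2 + 1)), (aoi M (P ω) n 0 t : ℝ)) / ((M * (K ^ 2 + 1) : ℕ) : ℝ))
      atTop (𝓝 ((M : ℝ) / (γ * pS N M V ρ γ * (1 - (1 - ρ) ^ M))
        - (M : ℝ) * (1 - ρ) ^ M / (1 - (1 - ρ) ^ M) + 1 / ρ - ((M : ℝ) + 1) / 2
        + (∑ α ∈ Icc 2 M, phi N M V ρ γ α * (α : ℝ)) / pS N M V ρ γ)) := by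
  have hM0 : 0 < M := by omega
  have hMR : (0 : ℝ) < M := by exact_mod_cast hM0
  have hp := pUpdate_pos hM0 hρ hρ1
  have : Nonempty (Fin N → UserFrame M V) := ⟨fun _ => (fun _ => true, true, ⟨0, hV⟩)⟩
  set p := pUpdate M ρ with hpdef
  set σ := pS N M V ρ γ with hσ
  set τ := ∑ α ∈ Icc 2 M, phi N M V ρ γ α * (α : ℝ) with hτ
  set η := p / ρ - M * (1 - ρ) ^ M with hη
  have hq : frameMean (V := V) (N := N) (M := M) ρ γ (resetInd (isServed n)) = γ * p * σ := by
    have := frameMean_resetInd_mul hV ρ γ n (fun _ : Fin M → Bool => (1 : ℝ))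
    simpa only [mul_one, arrivalMean_one] using this
  have hqW : frameMean (V := V) ρ γ (fun z : Fin N → UserFrame M V =>
      resetInd (isServed n) z * (resetValue n z - M)) = γ * η * σ := by
    have := frameMean_resetInd_mul hV ρ γ n (fun a : Fin M → Bool => (M : ℝ) - lastArrival a)
    rw [arrivalMean_sub_lastArrival hM0 hρ] at this
    rw [← this]
    congr 1
    funext z
    rw [resetValue]
    ring
  have he : frameMean (V := V) ρ γ (restTime n : (Fin N → UserFrame M V) → ℝ) =
      γ * p * (M * σ - τ) := by
    have := frameMean_restTime_mul hV ρ γ n (fun _ : Fin M → Bool => (1 : ℝ))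
    simpa only [mul_one, arrivalMean_one] using this
  have heW : frameMean (V := V) ρ γ (fun z : Fin N → UserFrame M V =>
      restTime n z * (resetValue n z - M)) = γ * η * (M * σ - τ) := by
    have := frameMean_restTime_mul hV ρ γ n (fun a : Fin M → Bool => (M : ℝ) - lastArrival a)
    rw [arrivalMean_sub_lastArrival hM0 hρ] at this
    rw [← this]
    congr 1
    funext z
    rw [resetValue]
    ring
  have hX := hP.isRepeated (M := M)
  filter_upwards [hX.ae_tendsto_resetAge M (isServed n) (resetValue n) (by rw [hq]; positivity)
      (restTime n), hX.ae_tendsto_average_sq (fun z => restTime n z * (resetValue n z - M))]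
    with ω hω h4
  obtain ⟨h1, h2, h3⟩ := hω
  rw [hq, hqW] at h2 h3
  rw [he] at h3
  rw [heW] at h4
  set A := resetAge M (isServed n) (resetValue n) (fun i => frameOf M (P ω) i) with hA
  constructor
  -- Without any reception the age would be linear, against A_k/k → 0 along the squares.
  · by_contra hnot
    push Not at hnot
    have hAk : ∀ k, A k = (k + 1) * M := by
      intro k
      induction k with
      | zero => simp [hA, resetAge]
      | succ k ih =>
        rw [hA, resetAge, ← hA, if_neg, ih]
        · push_cast; ring
        · intro hs
          obtain ⟨j, hj, hs⟩ := of_decide_eq_true hs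
          exact hnot _ ((received_iff_served hM0 (P ω) n k (by omega)).2 hs)
    have hge : ∀ᶠ K : ℕ in atTop, (M : ℝ) ≤ A (K ^ 2) / ((K ^ 2 : ℕ) : ℝ) := by
      filter_upwards [eventually_gt_atTop 0] with K hK
      have hK' : (0 : ℝ) < ((K ^ 2 : ℕ) : ℝ) := by exact_mod_cast pow_pos hK 2
      rw [hAk, le_div_iff₀ hK']
      nlinarith
    have := ge_of_tendsto h1 hge
    linarith
  · have hdiv : Tendsto (fun K : ℕ => ((K ^ 2 : ℕ) : ℝ) / (((K ^ 2 : ℕ) : ℝ) + 1)) atTop (𝓝 1) :=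
      (tendsto_natCast_div_add_atTop (1 : ℝ)).comp tendsto_sq_atTop
    have hc : Tendsto (fun K : ℕ => ((M : ℝ) * (M - 1) / 2) / ((K ^ 2 : ℕ) : ℝ)) atTop (𝓝 0) :=
      (tendsto_const_div_atTop_nhds_zero_nat _).comp tendsto_sq_atTop
    have hlim := ((((hc.add (h2.const_mul (M : ℝ))).add_const ((M : ℝ) * (M - 1) / 2)).sub
      (h3.sub h4)).mul hdiv).div_const (M : ℝ)
    -- The mean age at a frame start is M/(γpσ) + η/p. Subtracting what reception saves in a frame
    -- cancels all products with τ and η, leaving Mτ/σ before division by M.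
    have hval : (0 + (M : ℝ) * ((M + γ * η * σ) / (γ * p * σ)) + (M : ℝ) * (M - 1) / 2 -
        ((M + γ * η * σ) / (γ * p * σ) * (γ * p * (M * σ - τ)) - γ * η * (M * σ - τ))) * 1 / M =
        (M : ℝ) / (γ * σ * (1 - (1 - ρ) ^ M))
        - (M : ℝ) * (1 - ρ) ^ M / (1 - (1 - ρ) ^ M) + 1 / ρ - ((M : ℝ) + 1) / 2 + τ / σ := by
      have hp' : (1 - ρ) ^ M = 1 - p := by rw [hpdef, pUpdate]; ring
      rw [hη, hp', sub_sub_cancel]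
      field_simp
      ring
    rw [hval] at hlim
    refine hlim.congr' ?_
    filter_upwards [eventually_gt_atTop 0] with K hK
    have hK' : (0 : ℝ) < ((K ^ 2 : ℕ) : ℝ) := by exact_mod_cast pow_pos hK 2
    rw [sum_aoi_frames hM, sum_congr rfl fun k _ => sum_aoi_frame hM (P ω) n k]
    change _ = (_ + ∑ k ∈ range (K ^ 2), ((M : ℝ) * A k + M * (M - 1) / 2 -
      (A k * restTime n (frameOf M (P ω) k) - restTime n (frameOf M (P ω) k) *
        (resetValue n (frameOf M (P ω) k) - M)))) / _
    rw [sum_sub_distrib, sum_add_distrib, sum_sub_distrib, ← mul_sum, sum_const, card_range,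
      nsmul_eq_mul, Nat.cast_mul, Nat.cast_add_one]
    field_simp
    ring

end Law

/-- Partial sums of a nonnegative sequence are monotone, and consecutive terms of M(K² + 1) have
ratio tending to 1, so intermediate averages are squeezed. -/
lemma tendsto_average_of_tendsto_sq (hM : 0 < M) {f : ℕ → ℝ} (hf : ∀ t, 0 ≤ f t) {l : ℝ}
    (h : Tendsto (fun K : ℕ => (∑ t ∈ range (M * (K ^ 2 + 1)), f t) /
      ((M * (K ^ 2 + 1) : ℕ) : ℝ)) atTop (𝓝 l)) :
    Tendsto (fun T : ℕ => (∑ t ∈ range T, f t) / (T : ℝ)) atTop (𝓝 l) := by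
  refine tendsto_div_of_monotone_of_exists_subseq_tendsto_div _ l
    (fun a b hab => sum_le_sum_of_subset_of_nonneg (range_mono hab) fun t _ _ => hf t)
    fun a ha => ⟨fun K => M * (K ^ 2 + 1), ?_, ?_, h⟩
  -- What is needed is 2K + 1 ≤ (a - 1)(K² + 1); it follows from (a - 1)K ≥ 3 and K ≥ 1, since 3K ≥
  -- 2K + 1.
  · filter_upwards [eventually_ge_atTop 1, eventually_ge_atTop ⌈3 / (a - 1)⌉₊] with K hK1 hK
    have hK1' : (1 : ℝ) ≤ K := by exact_mod_cast hK1
    have ha' : 0 < a - 1 := by linarith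
    have hK' : 3 / (a - 1) ≤ K := (Nat.le_ceil _).trans (by exact_mod_cast hK)
    rw [div_le_iff₀ ha'] at hK'
    have hMR : (0 : ℝ) < M := by exact_mod_cast hM
    push_cast
    have : ((K : ℝ) + 1) ^ 2 + 1 ≤ a * ((K : ℝ) ^ 2 + 1) := by nlinarith
    nlinarith
  · refine tendsto_atTop_mono (fun K => ?_) tendsto_id
    have : K ≤ K ^ 2 := Nat.le_self_pow two_ne_zero K
    simp only [id]
    nlinarith

/-- The initial value has no influence on the average age. -/
lemma tendsto_average_aoi_of_received {P : Path N V} {n : Fin N} {t₀ : ℕ}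
    (h : Received M P n t₀) (u : ℤ) {l : ℝ}
    (hl : Tendsto (fun T : ℕ => (∑ t ∈ range T, (aoi M P n 0 t : ℝ)) / (T : ℝ)) atTop (𝓝 l)) :
    Tendsto (fun T : ℕ => (∑ t ∈ range T, (aoi M P n u t : ℝ)) / (T : ℝ)) atTop (𝓝 l) := by
  -- The two ages agree after `t₀`, so `C` is the whole difference of the partial sums and vanishes
  -- on division by T.
  set C := ∑ t ∈ range (t₀ + 1), ((aoi M P n u t : ℝ) - aoi M P n 0 t) with hC
  have h1 := hl.add (tendsto_const_div_atTop_nhds_zero_nat C)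
  rw [add_zero] at h1
  refine h1.congr' ?_
  filter_upwards [eventually_ge_atTop (t₀ + 1)] with T hT
  have h2 : C = ∑ t ∈ range T, ((aoi M P n u t : ℝ) - aoi M P n 0 t) := by
    refine sum_subset (range_mono hT) fun t _ ht => ?_
    rw [aoi, aoi, latestGen_eq_of_received h u 0 (by simpa using ht), sub_self]
  rw [h2, sum_sub_distrib]
  ring

end FSARD

theorem mainTheorem1 {Ω : Type*} [MeasurableSpace Ω] (μ : MeasureTheory.Measure Ω)
    [MeasureTheory.IsProbabilityMeasure μ]
    (N M V : ℕ) (hM : 2 ≤ M) (hV : 1 ≤ V) (ρ γ : ℝ)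
    (hρ : 0 < ρ) (hρ1 : ρ ≤ 1) (hγ : 0 < γ) (hγ1 : γ ≤ 1)
    -- in the one excluded case every reservation of every frame `k ≥ 1` collides
    (hne : ¬ (V = 1 ∧ 2 ≤ N ∧ ρ = 1 ∧ γ = 1))
    (P : Ω → FSARD.Path N V) (hP : FSARD.IsNetwork μ ρ γ P)
    (n : Fin N) (u₀ : Ω → ℤ) :
    -- `p_s` is the probability of a successful update, given that the user reserves
    0 < FSARD.pS N M V ρ γ ∧
    (∀ k : ℕ, 1 ≤ k →
      (ProbabilityTheory.cond μ {ω | FSARD.Reserves M (P ω) n k}).real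
        {ω | FSARD.ReceivedInFrame M (P ω) n k} = FSARD.pS N M V ρ γ) ∧
    -- `φ_α` is the probability of an update in the `α`-th slot of the frame, given the same
    (∀ k : ℕ, 1 ≤ k → ∀ α ∈ Finset.Icc 2 M,
      (ProbabilityTheory.cond μ {ω | FSARD.Reserves M (P ω) n k}).real
        {ω | FSARD.Received M (P ω) n (k * M + (α - 1))} = FSARD.phi N M V ρ γ α) ∧
    -- the average age of information
    (∀ᵐ ω ∂μ, Filter.Tendsto
      (fun T : ℕ => (∑ t ∈ Finset.range T, (FSARD.aoi M (P ω) n (u₀ ω) t : ℝ)) / (T : ℝ))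
      Filter.atTop
      (nhds ((M : ℝ) / (γ * FSARD.pS N M V ρ γ * (1 - (1 - ρ) ^ M))
        - (M : ℝ) * (1 - ρ) ^ M / (1 - (1 - ρ) ^ M) + 1 / ρ - ((M : ℝ) + 1) / 2
        + (∑ α ∈ Finset.Icc 2 M, FSARD.phi N M V ρ γ α * (α : ℝ))
            / FSARD.pS N M V ρ γ))) := by
  have hM0 : 0 < M := by omega
  have hpS := FSARD.pS_pos hM hV hρ hρ1 hγ hγ1 hne n
  refine ⟨hpS, fun k hk => ?_, fun k hk α hα => ?_, ?_⟩
  · obtain ⟨k, rfl⟩ := Nat.exists_eq_add_of_le' hk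
    exact hP.cond_receivedInFrame hM0 hV hρ hρ1 hγ k n
  · obtain ⟨k, rfl⟩ := Nat.exists_eq_add_of_le' hk
    obtain ⟨j, rfl⟩ := Nat.exists_eq_add_of_le' (Finset.mem_Icc.1 hα).1
    exact hP.cond_received hM0 hV hρ hρ1 hγ k n (by have := (Finset.mem_Icc.1 hα).2; omega)
  -- The almost sure event is that of initial value 0; the passage to `u₀ ω` is made path by path.
  · filter_upwards [hP.ae_tendsto_sum_aoi hM hV hρ hρ1 hγ hpS n] with ω hω
    obtain ⟨⟨t₀, ht₀⟩, hlim⟩ := hω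
    exact FSARD.tendsto_average_aoi_of_received ht₀ (u₀ ω) (FSARD.tendsto_average_of_tendsto_sq hM0
      (fun t => by exact_mod_cast FSARD.aoi_nonneg (P ω) n t) hlim)
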